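/- Let $\mathbb{D}$ be the open unit disc and $\mathbb{T}$ the unit circle with normalised Lebesgue measure. $H^2$ and $H^\infty$ are the Hardy spaces, viewed as the subspaces of $L^2(\mathbb{T})$ and $L^\infty(\mathbb{T})$ of functions whose Fourier coefficients of negative index vanish; such a function $f$ with Fourier coefficients $(a_n)_{n\ge 0}$ is identified with the function $f(z)=\sum_{n\ge0}a_nz^n$ holomorphic on $\mathbb{D}$. For $\psi\in L^\infty(\mathbb{T})$ let $T_\psi f:=P_+(\psi f)$ be the Toeplitz operator on $H^2$, where $P_+$ is the orthogonal projection of $L^2(\mathbb{T})$ onto $H^2$. For $b$ in the closed unit ball of $H^\infty$, the de Branges--Rovnyak space $\mathcal{H}(b)$ is the range of $(I-T_bT_{\overline b})^{1/2}$ in $H^2$, with the inner product $$\big\langle (I-T_bT_{\overline b})^{1/2}f,\,(I-T_bT_{\overline b})^{1/2}g\big\rangle_b:=\langle f,g\rangle_{2}\qquad \big(f,g\in H^2\ominus\ker(I-T_bT_{\overline b})^{1/2}\big)$$ and associated norm $\|\cdot\|_b$. For $f(z)=\sum_{n\ge0}a_nz^n$ holomorphic on $\mathbb{D}$ put $s_n[f](z):=\sum_{k=0}^na_kz^k$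 and, for $r\in[0,1)$, $$L_r[f](z):=\frac{1}{l(r)}\sum_{n\ge0}\frac{s_n[f](z)}{n+1}\,r^n,\qquad l(r):=\sum_{n\ge0}\frac{r^n}{n+1},$$ so that $l(r)=\frac1r\log\frac1{1-r}$ for $0<r<1$ and $L_0[f]=f(0)$. Let $b$ be a non-extreme point of the closed unit ball of $H^\infty$. Let $a\in H^\infty$ be the outer function with $a(0)>0$ and $|a|^2+|b|^2=1$ a.e. on $\mathbb{T}$, let $\varphi:=b/a$, which is holomorphic on $\mathbb{D}$, say $\varphi(z)=\sum_{j\ge0}c_jz^j$, and put $$C(\varphi,r):=1+\frac{1}{1-r}\sum_{j\ge0}r^j|c_j|^2\qquad(0\le r<1).$$ Then this series converges for every $r\in[0,1)$, and $r\mapsto C(\varphi,r)$ is (weakly) increasing on $[0,1)$. For every $r\in[0,1)$ we have $L_r[f]\in\mathcal{H}(b)$ for all $f\in\mathcal{H}(b)$, the map $L_r:f\mapsto L_r[f]$ is a bounded linear operator on $\mathcal{H}(b)$ with $\|L_r\|\le\sqrt{C(\varphi,r)}$, and moreover $$\|L_r[f]\|_b\le\sqrt{C(\varphi,r)}\;\|f\|_{H^2}\qquad(f\in\mathcal{H}(b)).$$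 -/

import Mathlib

open MeasureTheory AddCircle Set
open scoped ENNReal ComplexConjugate

noncomputable section

namespace DBR

/-! The unit circle `𝕋` is `UnitAddCircle = ℝ / ℤ`, the point `x` standing for
`toCircle x = exp (2 π i x)`, with the normalised Lebesgue measure `haarAddCircle`.
`H²` and `H^∞` are the spaces of boundary functions, each boundary function `f` being identified
with the function `f(z) = ∑ aₙ zⁿ` holomorphic in the disc, `aₙ` its Fourier coefficients. -/

/-- `L^p(𝕋)` -/
abbrev LpT (p : ℝ≥0∞) : Type := Lp ℂ p (haarAddCircle (T := (1 : ℝ)))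

lemma integrable_of_one_le {p : ℝ≥0∞} (hp : 1 ≤ p) (f : LpT p) :
    Integrable f (haarAddCircle (T := (1 : ℝ))) :=
  (Lp.memLp f).integrable hp

/-- The Hardy space `H^p` (`1 ≤ p`), as the subspace of `L^p(𝕋)` of the functions whose Fourier
coefficients of negative index vanish. -/
def hardy (p : ℝ≥0∞) [hp : Fact (1 ≤ p)] : Submodule ℂ (LpT p) where
  carrier := {f | ∀ n : ℤ, n < 0 → fourierCoeff f n = 0}
  zero_mem' := fun n _ => by
    rw [fourierCoeff_congr_ae (Lp.coeFn_zero ℂ p _)]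
    simp [fourierCoeff]
  add_mem' := fun {f g} hf hg n hn => by
    rw [fourierCoeff_congr_ae (Lp.coeFn_add f g),
      fourierCoeff.add (integrable_of_one_le hp.out f) (integrable_of_one_le hp.out g),
      Pi.add_apply, hf n hn, hg n hn, add_zero]
  smul_mem' := fun c f hf n hn => by
    rw [fourierCoeff_congr_ae (Lp.coeFn_smul c f), fourierCoeff.const_smul, hf n hn, smul_zero]

/-- The Hardy space `H^∞` -/
abbrev Hinf : Submodule ℂ (LpT ∞) := hardy ∞

/-- The Hardy space `H²`, with the inner product of `L²(𝕋)`. It is made a type of its own only to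
help instance search. -/
def H2 : Type := hardy 2

instance : NormedAddCommGroup H2 := inferInstanceAs (NormedAddCommGroup (hardy 2))

instance : InnerProductSpace ℂ H2 := inferInstanceAs (InnerProductSpace ℂ (hardy 2))

/-- The inclusion `H² ⊆ L²(𝕋)`. -/
def H2.toLp : H2 →L[ℂ] LpT 2 := (hardy 2).subtypeL

lemma isClosed_hardy_two : IsClosed (hardy 2 : Set (LpT 2)) := by
  have h : (hardy 2 : Set (LpT 2)) =
      ⋂ n : ℤ, ⋂ _ : n < 0, {f : LpT 2 | (fourierBasis (T := (1 : ℝ))).repr f n = 0} := by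
    ext f
    simp only [mem_iInter, fourierBasis_repr]
    rfl
  rw [h]
  refine isClosed_iInter fun n => isClosed_iInter fun _ => isClosed_eq ?_ continuous_const
  exact (lp.evalCLM ℂ (fun _ : ℤ => ℂ) 2 n).continuous.comp
    (fourierBasis (T := (1 : ℝ))).repr.continuous

instance : CompleteSpace (hardy 2) := isClosed_hardy_two.completeSpace_coe

instance : CompleteSpace H2 := inferInstanceAs (CompleteSpace (hardy 2))

/-- The orthogonal projection `P₊` of `L²(𝕋)` onto `H²`. -/
def projPlus : LpT 2 →L[ℂ] H2 := (hardy 2).orthogonalProjectionOnto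

/-- The `n`-th Taylor coefficient of (the holomorphic extension to the disc of) a boundary
function. -/
def coeff (f : UnitAddCircle → ℂ) (n : ℕ) : ℂ := fourierCoeff f (n : ℤ)

/-- The `n`-th Taylor partial sum `sₙ[f](z)`. -/
def partialSum (f : UnitAddCircle → ℂ) (n : ℕ) (z : ℂ) : ℂ :=
  ∑ k ∈ Finset.range (n + 1), coeff f k * z ^ k

/-- The value `f(z)`, for `z` in the open unit disc, of the holomorphic extension of a boundary
function `f`. -/
def eval (f : UnitAddCircle → ℂ) (z : ℂ) : ℂ := ∑' n : ℕ, coeff f n * z ^ n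

/-- The Toeplitz operator `T_φ f = P₊ (φ f)` on `H²`, with symbol `φ ∈ L^∞(𝕋)`. -/
def toeplitz (φ : LpT ∞) : H2 →L[ℂ] H2 :=
  projPlus ∘L
    ((ContinuousLinearMap.mul ℂ ℂ).holderL (haarAddCircle (T := (1 : ℝ))) ∞ 2 2 φ) ∘L H2.toLp

/-- The operator `(I - T_b T_{b̄})^{1/2}` on `H²`. -/
def defect (b : Hinf) : H2 →L[ℂ] H2 :=
  CFC.sqrt (1 - toeplitz (b : LpT ∞) ∘L toeplitz (star (b : LpT ∞)))

/-- The de Branges--Rovnyak space `ℋ(b)`: the range of `(I - T_b T_{b̄})^{1/2}`. It is a type of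
its own because it does not carry the norm of `H²`. -/
def Hb (b : Hinf) : Type := (defect b).toLinearMap.range

instance (b : Hinf) : AddCommGroup (Hb b) :=
  inferInstanceAs (AddCommGroup (defect b).toLinearMap.range)

instance (b : Hinf) : Module ℂ (Hb b) :=
  inferInstanceAs (Module ℂ (defect b).toLinearMap.range)

/-- The inclusion `ℋ(b) ⊆ H²`. -/
def Hb.toH2 {b : Hinf} : Hb b →ₗ[ℂ] H2 := (defect b).toLinearMap.range.subtype

/-- The linear bijection `f ↦ (I - T_b T_{b̄})^{1/2} f` from `H² ⊖ ker (I - T_b T_{b̄})^{1/2}` onto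
`ℋ(b)`. -/
def Hb.param (b : Hinf) : (defect b).toLinearMap.kerᗮ ≃ₗ[ℂ] Hb b :=
  have : CompleteSpace (defect b).toLinearMap.ker := (defect b).isClosed_ker.completeSpace_coe
  (defect b).toLinearMap.kerComplementEquivRange
    (Submodule.isCompl_orthogonal _).symm

lemma Hb.toH2_param (b : Hinf) (f : (defect b).toLinearMap.kerᗮ) :
    Hb.toH2 (Hb.param b f) = defect b f := rfl

/-- The norm of `ℋ(b)`: `‖(I - T_b T_{b̄})^{1/2} f‖_b = ‖f‖₂` for `f ⟂ ker`. -/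
instance (b : Hinf) : NormedAddCommGroup (Hb b) :=
  NormedAddCommGroup.induced (Hb b) (defect b).toLinearMap.kerᗮ (Hb.param b).symm
    (Hb.param b).symm.injective

/-- The inner product of `ℋ(b)`:
`⟪(I - T_b T_{b̄})^{1/2} f, (I - T_b T_{b̄})^{1/2} g⟫_b = ⟪f, g⟫₂` for `f, g ⟂ ker`. -/
instance (b : Hinf) : InnerProductSpace ℂ (Hb b) where
  norm_smul_le c f := by
    change ‖(Hb.param b).symm (c • f)‖ ≤ ‖c‖ * ‖(Hb.param b).symm f‖
    rw [map_smul, norm_smul]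
  inner f g := inner ℂ ((Hb.param b).symm f) ((Hb.param b).symm g)
  norm_sq_eq_re_inner f := norm_sq_eq_re_inner (𝕜 := ℂ) ((Hb.param b).symm f)
  conj_inner_symm f g := inner_conj_symm ((Hb.param b).symm f) ((Hb.param b).symm g)
  add_left f g h := by
    rw [map_add]; exact inner_add_left _ _ _
  smul_left f g c := by
    rw [map_smul]; exact inner_smul_left _ _ _

/-- `b` is a point of the closed unit ball of `H^∞` that is not an extreme point of it. -/
def IsNonExtreme (b : Hinf) : Prop :=
  b ∈ Metric.closedBall (0 : Hinf) 1 ∧ b ∉ (Metric.closedBall (0 : Hinf) 1).extremePoints ℝ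

/-- `a ∈ H^∞` is outer: `log |a| ∈ L¹(𝕋)` and, with a unimodular constant `c`,
`a(z) = c exp (∫_𝕋 (ζ + z) / (ζ - z) log |a(ζ)| dm(ζ))` in the disc.
(The junk value `log 0 = 0` is harmless: the formula forces `a ≠ 0` in `H^∞`, so that `a` does not
vanish on a set of positive measure.) -/
def IsOuter (a : Hinf) : Prop :=
  Integrable (fun x => Real.log ‖(a : LpT ∞) x‖) (haarAddCircle (T := (1 : ℝ))) ∧
  ∃ c : ℂ, ‖c‖ = 1 ∧ ∀ z : ℂ, ‖z‖ < 1 →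
    eval (a : LpT ∞) z = c * Complex.exp
      (∫ x : UnitAddCircle, ((toCircle x : ℂ) + z) / ((toCircle x : ℂ) - z) *
        (Real.log ‖(a : LpT ∞) x‖ : ℂ) ∂(haarAddCircle (T := (1 : ℝ))))

/-- `(b, a)` is a Pythagorean pair: `a ∈ H^∞` is outer, `a(0) > 0`, and `|a|² + |b|² = 1` a.e. on
`𝕋`. -/
def IsPythagoreanPair (b a : Hinf) : Prop :=
  IsOuter a ∧
  (0 < (eval (a : LpT ∞) 0).re ∧ (eval (a : LpT ∞) 0).im = 0) ∧
  ∀ᵐ x ∂(haarAddCircle (T := (1 : ℝ))), ‖(a : LpT ∞) x‖ ^ 2 + ‖(b : LpT ∞) x‖ ^ 2 = 1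

/-- The holomorphic function `φ = b / a` on the disc. -/
def quotient (b a : Hinf) (z : ℂ) : ℂ := eval (b : LpT ∞) z / eval (a : LpT ∞) z

/-- The `j`-th Taylor coefficient at `0` of a function holomorphic on the disc. -/
def taylorCoeff (φ : ℂ → ℂ) (j : ℕ) : ℂ := iteratedDeriv j φ 0 / (j.factorial : ℂ)

/-- The constant `C(φ, r) = 1 + (∑ⱼ rʲ |cⱼ|²) / (1 - r)`, where `φ(z) = ∑ⱼ cⱼ zʲ`. -/
def constC (φ : ℂ → ℂ) (r : ℝ) : ℝ :=
  1 + (∑' j : ℕ, r ^ j * ‖taylorCoeff φ j‖ ^ 2) / (1 - r)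

/-- `l(r) = ∑ₙ rⁿ / (n + 1)`, the power series of the logarithmic method. -/
def logSeries (r : ℝ) : ℝ := ∑' n : ℕ, r ^ n / ((n : ℝ) + 1)

lemma logSeries_zero : logSeries 0 = 1 := by
  rw [logSeries, tsum_eq_single 0 (fun n hn => by simp [hn])]
  simp

lemma logSeries_eq {r : ℝ} (h0 : 0 < r) (h1 : r < 1) :
    logSeries r = 1 / r * Real.log (1 / (1 - r)) := by
  have h := (Real.hasSum_pow_div_log_of_abs_lt_one (abs_lt.2 ⟨by linarith, h1⟩)).mul_left (1 / r)
  rw [one_div (1 - r), Real.log_inv, ← h.tsum_eq, logSeries]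
  congr 1
  ext n
  rw [pow_succ]
  field_simp

/-- The logarithmic mean `L_r[f](z) = l(r)⁻¹ ∑ₙ sₙ[f](z) rⁿ / (n + 1)`; the factor `l(r)⁻¹` is
`r / log (1 / (1 - r))` for `0 < r < 1`, and `1` for `r = 0`. -/
def logMean (r : ℝ) (f : UnitAddCircle → ℂ) (z : ℂ) : ℂ :=
  ((logSeries r)⁻¹ : ℂ) * ∑' n : ℕ, partialSum f n z / ((n : ℂ) + 1) * (r : ℂ) ^ n

end DBR

end

noncomputable section

namespace DBR

/-! `L_r` multiplies the k-th Taylor coefficient by a weight w_k with 0 ≤ w_k ≤ r^k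
(`norm_logWeight_le`), and only this bound matters. Let h ∈ H^∞ satisfy |b|² + |h|² ≤ 1 a.e. and
h(0) ≠ 0, and let c = b/h as a formal power series. Every polynomial p equals T_{h̄} q with q =
T_{1/h̄} p again a polynomial, and then T_{b̄} q = T_{c̄} p (`exists_toeplitz_star_eq`). Duality
gives ‖p‖_b² ≤ ‖p‖₂² + ‖T_{c̄} p‖₂² (`norm_inner_toeplitz_star_le` with `exists_Hb_of_inner_le`). If
|p_k| ≤ r^k |f_k|, Cauchy–Schwarz bounds the squared m-th coefficient of T_{c̄} p by r^m (∑ r^j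
|c_j|²) ‖f‖₂², and summing over m produces C(c, r) ‖f‖₂². Truncating a general multiplier yields
`exists_multiplier`.

With h = a this is the stated bound. Existence of a bounded `L_r` is claimed independently of any
pair (b, a), so it is derived from non-extremality alone: some k ≠ 0 has |b|² + |k|² ≤ 1, and a
complement h that almost maximises |h(0)| has no zeros in a disc of radius ρ, for any prescribed ρ <
1 (`IsNonExtreme.exists_zeroFree`). Taking ρ > √r makes ∑ r^j |c_j|² converge for c = b/h. -/

/-- The normalised Lebesgue measure of the circle. -/
abbrev mT : Measure UnitAddCircle := haarAddCircle (T := (1 : ℝ))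

/-! ### H² through Fourier coefficients -/

lemma fourierCoeff_eq_zero_of_neg (f : H2) {n : ℤ} (hn : n < 0) :
    fourierCoeff (H2.toLp f) n = 0 :=
  (show hardy 2 from f).2 n hn

lemma H2.toLp_injective : Function.Injective H2.toLp := fun _ _ h => Subtype.ext h

lemma H2.norm_toLp (f : H2) : ‖H2.toLp f‖ = ‖f‖ := rfl

lemma projPlus_norm_le (f : LpT 2) : ‖projPlus f‖ ≤ ‖f‖ :=
  (hardy 2).norm_orthogonalProjectionOnto_apply_le f

lemma inner_projPlus_right (f : H2) (g : LpT 2) :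
    inner ℂ f (projPlus g) = inner ℂ (H2.toLp f) g :=
  (hardy 2).inner_orthogonalProjectionOnto_eq_of_mem_left (show hardy 2 from f) g

lemma inner_projPlus_left (f : H2) (g : LpT 2) :
    inner ℂ (projPlus g) f = inner ℂ g (H2.toLp f) := by
  rw [← inner_conj_symm, inner_projPlus_right, inner_conj_symm]

lemma inner_fourierLp (f : LpT 2) (n : ℤ) :
    inner ℂ (fourierLp (T := (1 : ℝ)) 2 n) f = fourierCoeff f n := by
  rw [← fourierBasis_repr, HilbertBasis.repr_apply_apply, coe_fourierBasis]

lemma hasSum_inner_fourierCoeff (f g : LpT 2) :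
    HasSum (fun n : ℤ => conj (fourierCoeff f n) * fourierCoeff g n) (inner ℂ f g) := by
  refine ((fourierBasis (T := (1 : ℝ))).hasSum_inner_mul_inner f g).congr_fun fun n => ?_
  rw [coe_fourierBasis, ← inner_conj_symm f, inner_fourierLp, inner_fourierLp]

lemma hasSum_of_hasSum_int {u : ℤ → ℂ} {s : ℂ} (h : HasSum u s) (hu : ∀ n < 0, u n = 0) :
    HasSum (fun n : ℕ => u n) s := by
  refine (Function.Injective.hasSum_iff Nat.cast_injective ?_).2 h
  intro n hn
  refine hu n (not_le.1 fun h0 => hn ⟨n.toNat, Int.toNat_of_nonneg h0⟩)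

/-- Parseval's identity in `H²`. -/
lemma hasSum_inner_coeff (f g : H2) :
    HasSum (fun n : ℕ => conj (coeff (H2.toLp f) n) * coeff (H2.toLp g) n) (inner ℂ f g) :=
  hasSum_of_hasSum_int (hasSum_inner_fourierCoeff (H2.toLp f) (H2.toLp g)) fun n hn => by
    rw [fourierCoeff_eq_zero_of_neg f hn]; simp

lemma hasSum_sq_coeff (f : H2) :
    HasSum (fun n : ℕ => ‖coeff (H2.toLp f) n‖ ^ 2) (‖f‖ ^ 2) := by
  have h := hasSum_inner_coeff f f
  rw [inner_self_eq_norm_sq_to_K] at h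
  have : (fun n : ℕ => conj (coeff (H2.toLp f) n) * coeff (H2.toLp f) n) =
      fun n => ((‖coeff (H2.toLp f) n‖ ^ 2 : ℝ) : ℂ) := by
    ext n; rw [Complex.conj_mul']; push_cast; rfl
  rw [this] at h
  refine Complex.hasSum_ofReal.1 ?_
  rw [Complex.ofReal_pow]
  exact h

lemma norm_coeff_le (f : H2) (n : ℕ) : ‖coeff (H2.toLp f) n‖ ≤ ‖f‖ := by
  refine abs_le_of_sq_le_sq' ?_ (norm_nonneg _) |>.2
  exact le_hasSum (hasSum_sq_coeff f) n fun _ _ => by positivity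

lemma H2.ext_coeff {f g : H2} (h : ∀ n, coeff (H2.toLp f) n = coeff (H2.toLp g) n) : f = g := by
  apply H2.toLp_injective
  apply (fourierBasis (T := (1 : ℝ))).repr.injective
  ext n
  rw [fourierBasis_repr, fourierBasis_repr]
  rcases lt_or_ge n 0 with hn | hn
  · rw [fourierCoeff_eq_zero_of_neg _ hn, fourierCoeff_eq_zero_of_neg _ hn]
  · lift n to ℕ using hn
    exact h n

lemma coeff_toLp_add (f g : H2) (n : ℕ) :
    coeff (H2.toLp (f + g)) n = coeff (H2.toLp f) n + coeff (H2.toLp g) n := by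
  simp only [coeff, ← inner_fourierLp, map_add, inner_add_right]

lemma coeff_toLp_smul (c : ℂ) (f : H2) (n : ℕ) :
    coeff (H2.toLp (c • f)) n = c * coeff (H2.toLp f) n := by
  simp only [coeff, ← inner_fourierLp, map_smul, inner_smul_right]

/-- The Riesz--Fischer theorem for `H²`. -/
lemma exists_coeff_eq {c : ℕ → ℂ} (hc : Summable fun n => ‖c n‖ ^ 2) :
    ∃ f : H2, ∀ n, coeff (H2.toLp f) n = c n := by
  let d : ℤ → ℂ := fun n => if 0 ≤ n then c n.toNat else 0
  have hd : Memℓp d 2 := by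
    refine memℓp_gen ?_
    have : Summable (fun n : ℤ => ‖d n‖ ^ 2) := by
      refine (Function.Injective.summable_iff (Nat.cast_injective (R := ℤ)) ?_).1 ?_
      · intro n hn
        have : ¬ 0 ≤ n := fun h0 => hn ⟨n.toNat, Int.toNat_of_nonneg h0⟩
        simp [d, this]
      · simpa [d, Function.comp_def] using hc
    simpa using this
  let F : LpT 2 := (fourierBasis (T := (1 : ℝ))).repr.symm ⟨d, hd⟩
  have hF : ∀ n : ℤ, fourierCoeff F n = d n := fun n => by
    rw [← fourierBasis_repr]
    simp only [F, LinearIsometryEquiv.apply_symm_apply]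
  refine ⟨(⟨F, fun n hn => ?_⟩ : hardy 2), fun n => ?_⟩
  · rw [hF]; simp [d, not_le.2 hn]
  · refine (hF n).trans ?_
    simp [d]

/-! ### Toeplitz operators on coefficients -/

lemma fourierCoeff_conj (φ : UnitAddCircle → ℂ) (n : ℤ) :
    fourierCoeff (fun t => conj (φ t)) n = conj (fourierCoeff φ (-n)) := by
  rw [fourierCoeff, fourierCoeff, ← integral_conj]
  congr 1 with t
  simp only [smul_eq_mul, map_mul, neg_neg, fourier_neg]

lemma fourierCoeff_fourier_mul (φ : UnitAddCircle → ℂ) (m n : ℤ) :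
    fourierCoeff (fun t => fourier m t * φ t) n = fourierCoeff φ (n - m) := by
  rw [fourierCoeff, fourierCoeff]
  congr 1 with t
  simp only [smul_eq_mul, ← mul_assoc, ← fourier_add]
  congr 3
  ring

lemma memLp_fourier_mul {p : ℝ≥0∞} {φ : UnitAddCircle → ℂ} (hφ : MemLp φ p mT) (m : ℤ) :
    MemLp (fun t => fourier m t * φ t) p mT := by
  refine hφ.of_le ?_ (ae_of_all _ fun t => ?_)
  · exact (map_continuous (fourier m)).aestronglyMeasurable.mul hφ.1
  · simp only [norm_mul, fourier_apply, Circle.norm_coe, one_mul, le_refl]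

/-- Parseval's identity for x and the conjugate of e^{-int} φ. -/
lemma hasSum_fourierCoeff_mul {φ : UnitAddCircle → ℂ} (hφ : MemLp φ 2 mT) (x : LpT 2) (n : ℤ) :
    HasSum (fun k => fourierCoeff φ (n - k) * fourierCoeff x k)
      (fourierCoeff (fun t => φ t * x t) n) := by
  have hψ := (memLp_fourier_mul hφ (-n)).star
  have h := hasSum_inner_fourierCoeff hψ.toLp x
  convert h using 1
  · ext k
    rw [fourierCoeff_congr_ae hψ.coeFn_toLp]
    congr 1
    have := fourierCoeff_conj (fun t => fourier (-n) t * φ t) k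
    rw [fourierCoeff_fourier_mul] at this
    have h2 : fourierCoeff (star fun t => fourier (-n) t * φ t) k =
      fourierCoeff (fun t => conj (fourier (-n) t * φ t)) k := rfl
    rw [h2, this, Complex.conj_conj]
    congr 1; ring
  · rw [L2.inner_def, fourierCoeff]
    refine integral_congr_ae ?_
    filter_upwards [hψ.coeFn_toLp] with t ht
    rw [ht]
    simp only [smul_eq_mul, Pi.star_apply, RCLike.inner_apply', RCLike.star_def, Complex.conj_conj]
    ring

/-- The product of a bounded function and a square integrable one. -/
def mulLp (φ : LpT ∞) : LpT 2 →L[ℂ] LpT 2 :=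
  (ContinuousLinearMap.mul ℂ ℂ).holderL mT ∞ 2 2 φ

lemma toeplitz_apply (φ : LpT ∞) (x : H2) : toeplitz φ x = projPlus (mulLp φ (H2.toLp x)) := rfl

lemma coeFn_mulLp (φ : LpT ∞) (x : LpT 2) : mulLp φ x =ᵐ[mT] fun t => φ t * x t :=
  (ContinuousLinearMap.mul ℂ ℂ).coeFn_holder φ x

lemma memLp_two (φ : LpT ∞) : MemLp φ 2 mT := (Lp.memLp φ).mono_exponent le_top

lemma coeff_projPlus (f : LpT 2) (n : ℕ) : coeff (H2.toLp (projPlus f)) n = fourierCoeff f n := by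
  have hmem : fourierLp (T := (1 : ℝ)) 2 n ∈ hardy 2 := by
    intro m hm
    rw [fourierCoeff_congr_ae (coeFn_fourierLp 2 (n : ℤ)), fourierCoeff_fourier]
    exact Pi.single_eq_of_ne (by lia) _
  have h := inner_projPlus_right (⟨_, hmem⟩ : hardy 2) f
  exact (inner_fourierLp _ _).symm.trans (h.trans (inner_fourierLp _ _))

lemma hasSum_coeff_toeplitz (φ : LpT ∞) (x : H2) (n : ℕ) :
    HasSum (fun k : ℕ => fourierCoeff φ (n - k) * coeff (H2.toLp x) k)
      (coeff (H2.toLp (toeplitz φ x)) n) := by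
  rw [toeplitz_apply, coeff_projPlus, fourierCoeff_congr_ae (coeFn_mulLp φ (H2.toLp x))]
  refine hasSum_of_hasSum_int (hasSum_fourierCoeff_mul (memLp_two φ) _ n) fun k hk => ?_
  rw [fourierCoeff_eq_zero_of_neg x hk, mul_zero]

/-- The power series of a boundary function. -/
def series (f : UnitAddCircle → ℂ) : PowerSeries ℂ := PowerSeries.mk (coeff f)

/-- With no negative coefficients on either side, the convolution is a Cauchy product. Commutation
of analytic Toeplitz operators follows. -/
lemma series_toeplitz (β : Hinf) (x : H2) :
    series (H2.toLp (toeplitz (β : LpT ∞) x)) = series (β : LpT ∞) * series (H2.toLp x) := by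
  ext n
  rw [mul_comm, PowerSeries.coeff_mul, Finset.Nat.sum_antidiagonal_eq_sum_range_succ
    (fun i j => PowerSeries.coeff i (series (H2.toLp x)) *
      PowerSeries.coeff j (series (β : LpT ∞)))]
  simp only [series, PowerSeries.coeff_mk]
  refine (hasSum_coeff_toeplitz (β : LpT ∞) x n).unique ?_
  have h := hasSum_sum_of_ne_finset_zero (L := .unconditional ℕ) (s := Finset.range (n + 1))
    (f := fun k : ℕ => fourierCoeff (β : LpT ∞) (n - k) * coeff (H2.toLp x) k) (by
      intro k hk
      rw [β.2 _ (by simp at hk; lia), zero_mul])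
  convert h using 1
  refine Finset.sum_congr rfl fun k hk => ?_
  rw [mul_comm, coeff]
  congr 2
  simp at hk
  lia

lemma coeFn_star (φ : LpT ∞) : (star φ : LpT ∞) =ᵐ[mT] fun t => conj (φ t) :=
  AEEqFun.coeFn_star _

lemma hasSum_coeff_toeplitz_star (β : Hinf) (x : H2) (m : ℕ) :
    HasSum (fun i : ℕ => conj (coeff (β : LpT ∞) i) * coeff (H2.toLp x) (m + i))
      (coeff (H2.toLp (toeplitz (star (β : LpT ∞)) x)) m) := by
  have h := hasSum_coeff_toeplitz (star (β : LpT ∞)) x m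
  simp only [fourierCoeff_congr_ae (coeFn_star (β : LpT ∞)), fourierCoeff_conj] at h
  refine ((Function.Injective.hasSum_iff (add_right_injective m) ?_).2 h).congr_fun ?_
  · intro k hk
    rw [β.2, map_zero, zero_mul]
    by_contra hc
    exact hk ⟨k - m, by simp; lia⟩
  · intro i
    simp only [Function.comp, coeff]
    congr 3
    push_cast; ring

lemma toeplitz_comm (β γ : Hinf) (x : H2) :
    toeplitz (β : LpT ∞) (toeplitz (γ : LpT ∞) x) =
      toeplitz (γ : LpT ∞) (toeplitz (β : LpT ∞) x) := by
  refine H2.ext_coeff fun n => ?_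
  have h : series (H2.toLp (toeplitz (β : LpT ∞) (toeplitz (γ : LpT ∞) x))) =
      series (H2.toLp (toeplitz (γ : LpT ∞) (toeplitz (β : LpT ∞) x))) := by
    simp only [series_toeplitz]; ring
  simpa [series] using congrArg (PowerSeries.coeff n) h

lemma inner_toeplitz_star_left (φ : LpT ∞) (x y : H2) :
    inner ℂ (toeplitz (star φ) x) y = inner ℂ x (toeplitz φ y) := by
  rw [toeplitz_apply, toeplitz_apply, inner_projPlus_left, inner_projPlus_right, L2.inner_def,
    L2.inner_def]
  refine integral_congr_ae ?_
  filter_upwards [coeFn_mulLp (star φ) (H2.toLp x), coeFn_mulLp φ (H2.toLp y), coeFn_star φ]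
    with t h1 h2 h3
  rw [h1, h2, h3]
  simp only [RCLike.inner_apply', map_mul, Complex.conj_conj]
  ring

lemma norm_sq_eq_integral (f : LpT 2) : ‖f‖ ^ 2 = ∫ t, ‖f t‖ ^ 2 ∂mT :=
  have h := hasSum_sq_fourierCoeff f
  have h' : HasSum (fun n : ℤ => ((‖fourierCoeff f n‖ ^ 2 : ℝ) : ℂ)) ((‖f‖ ^ 2 : ℝ) : ℂ) := by
    have := hasSum_inner_fourierCoeff f f
    rw [inner_self_eq_norm_sq_to_K] at this
    simp only [Complex.conj_mul'] at this
    simp only [Complex.ofReal_pow]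
    exact this
  (Complex.hasSum_ofReal.1 h').unique h

lemma norm_sq_toeplitz_add_le {β γ : LpT ∞} (h : ∀ᵐ t ∂mT, ‖β t‖ ^ 2 + ‖γ t‖ ^ 2 ≤ 1) (x : H2) :
    ‖toeplitz β x‖ ^ 2 + ‖toeplitz γ x‖ ^ 2 ≤ ‖x‖ ^ 2 := by
  have hint : ∀ f : LpT 2, Integrable (fun t => ‖f t‖ ^ 2) mT := fun f =>
    (Lp.memLp f).integrable_norm_pow (by simp)
  have hβ : ‖toeplitz β x‖ ^ 2 ≤ ‖mulLp β (H2.toLp x)‖ ^ 2 := by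
    gcongr; exact projPlus_norm_le _
  have hγ : ‖toeplitz γ x‖ ^ 2 ≤ ‖mulLp γ (H2.toLp x)‖ ^ 2 := by
    gcongr; exact projPlus_norm_le _
  refine (add_le_add hβ hγ).trans ?_
  rw [norm_sq_eq_integral, norm_sq_eq_integral, ← integral_add (hint _) (hint _), ← H2.norm_toLp,
    norm_sq_eq_integral]
  refine integral_mono_ae ((hint _).add (hint _)) (hint _) ?_
  filter_upwards [coeFn_mulLp β (H2.toLp x), coeFn_mulLp γ (H2.toLp x), h] with t h1 h2 h3
  simp only [h1, h2, norm_mul, mul_pow, ← add_mul]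
  exact mul_le_of_le_one_left (by positivity) h3

/-! ### The defect operator and membership in ℋ(b) -/

section Operators

variable {b h : Hinf} (hbh : ∀ᵐ t ∂mT, ‖(b : LpT ∞) t‖ ^ 2 + ‖(h : LpT ∞) t‖ ^ 2 ≤ 1)

lemma inner_toeplitz_left (φ : LpT ∞) (x y : H2) :
    inner ℂ (toeplitz φ x) y = inner ℂ x (toeplitz (star φ) y) := by
  rw [← inner_conj_symm, ← inner_toeplitz_star_left, inner_conj_symm]

include hbh in
lemma norm_toeplitz_star_le (x : H2) : ‖toeplitz (star (b : LpT ∞)) x‖ ≤ ‖x‖ := by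
  have h1 : ∀ᵐ t ∂mT, ‖(star (b : LpT ∞) : LpT ∞) t‖ ^ 2 + ‖(star (h : LpT ∞) : LpT ∞) t‖ ^ 2
      ≤ 1 := by
    filter_upwards [hbh, coeFn_star (b : LpT ∞), coeFn_star (h : LpT ∞)] with t h1 h2 h3
    rwa [h2, h3, RCLike.norm_conj, RCLike.norm_conj]
  have h2 := norm_sq_toeplitz_add_le h1 x
  exact abs_le_of_sq_le_sq' (by nlinarith [sq_nonneg ‖toeplitz (star (h : LpT ∞)) x‖])
    (norm_nonneg _) |>.2

lemma inner_one_sub_toeplitz (x y : H2) :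
    inner ℂ ((1 - toeplitz (b : LpT ∞) ∘L toeplitz (star (b : LpT ∞))) x) y =
      inner ℂ x y - inner ℂ (toeplitz (star (b : LpT ∞)) x) (toeplitz (star (b : LpT ∞)) y) := by
  rw [← inner_toeplitz_left, ← inner_sub_left]; rfl

include hbh in
-- Guarantees that `CFC.sqrt` in `defect` is a genuine square root.
lemma one_sub_toeplitz_nonneg :
    0 ≤ 1 - toeplitz (b : LpT ∞) ∘L toeplitz (star (b : LpT ∞)) := by
  rw [ContinuousLinearMap.nonneg_iff_isPositive, ContinuousLinearMap.isPositive_iff']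
  refine ⟨?_, fun x => ?_⟩
  · rw [ContinuousLinearMap.isSelfAdjoint_iff_isSymmetric]
    intro x y
    have h := congrArg conj (inner_one_sub_toeplitz (b := b) y x)
    rw [inner_conj_symm, map_sub, inner_conj_symm, inner_conj_symm] at h
    exact (inner_one_sub_toeplitz x y).trans h.symm
  · rw [inner_one_sub_toeplitz, inner_self_eq_norm_sq_to_K, inner_self_eq_norm_sq_to_K]
    have := norm_toeplitz_star_le hbh x
    have h2 : ‖toeplitz (star (b : LpT ∞)) x‖ ^ 2 ≤ ‖x‖ ^ 2 := by gcongr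
    have h3 := (RCLike.ofReal_nonneg (K := ℂ)).2 (sub_nonneg.2 h2)
    rwa [RCLike.ofReal_sub, RCLike.ofReal_pow, RCLike.ofReal_pow] at h3

lemma defect_isSymmetric (b : Hinf) (x y : H2) :
    inner ℂ (defect b x) y = inner ℂ x (defect b y) := by
  have h := CFC.sqrt_nonneg (1 - toeplitz (b : LpT ∞) ∘L toeplitz (star (b : LpT ∞)))
  rw [ContinuousLinearMap.nonneg_iff_isPositive] at h
  exact h.isSymmetric x y

include hbh in
lemma norm_sq_defect (x : H2) :
    ‖defect b x‖ ^ 2 = ‖x‖ ^ 2 - ‖toeplitz (star (b : LpT ∞)) x‖ ^ 2 := by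
  have h1 : defect b (defect b x) =
      (1 - toeplitz (b : LpT ∞) ∘L toeplitz (star (b : LpT ∞))) x :=
    congrArg (fun A : H2 →L[ℂ] H2 => A x) (CFC.sqrt_mul_sqrt_self _ (one_sub_toeplitz_nonneg hbh))
  have h2 := inner_one_sub_toeplitz (b := b) x x
  rw [← h1, defect_isSymmetric, inner_self_eq_norm_sq_to_K, inner_self_eq_norm_sq_to_K,
    inner_self_eq_norm_sq_to_K] at h2
  apply Complex.ofReal_injective
  simpa using h2

include hbh in
-- The defect operator is a contraction. This turns bounds by the H² norm into operator bounds on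
-- ℋ(b).
lemma norm_toH2_le (F : Hb b) : ‖Hb.toH2 F‖ ≤ ‖F‖ := by
  obtain ⟨y, rfl⟩ := (Hb.param b).surjective F
  have h1 : ‖Hb.param b y‖ = ‖(y : H2)‖ := by
    change ‖(Hb.param b).symm (Hb.param b y)‖ = _
    rw [LinearEquiv.symm_apply_apply]; rfl
  rw [h1, Hb.toH2_param]
  have h2 := norm_sq_defect hbh (y : H2)
  exact abs_le_of_sq_le_sq' (by nlinarith [sq_nonneg ‖toeplitz (star (b : LpT ∞)) (y : H2)‖])
    (norm_nonneg _) |>.2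

/-- Douglas' criterion for membership in `ℋ(b)`. -/
lemma exists_Hb_of_inner_le {b : Hinf} {g : H2} {M : ℝ} (hM : 0 ≤ M)
    (hg : ∀ x, ‖inner ℂ g x‖ ≤ M * ‖defect b x‖) :
    ∃ F : Hb b, Hb.toH2 F = g ∧ ‖F‖ ≤ M := by
  have hcomp : CompleteSpace (defect b).toLinearMap.ker :=
    (defect b).isClosed_ker.completeSpace_coe
  have hker : ∀ x, defect b x = 0 → inner ℂ g x = 0 := fun x hx => by
    have := hg x
    rw [hx, norm_zero, mul_zero] at this
    exact norm_le_zero_iff.1 this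
  let p := (defect b).toLinearMap.range
  -- With D the defect operator, Dx ↦ ⟨g, x⟩ is defined on the range by choosing preimages; `hker`
  -- makes the choice irrelevant.
  let s : p → H2 := fun y => y.2.choose
  have hs : ∀ y : p, defect b (s y) = y := fun y => y.2.choose_spec
  have hsx : ∀ (y : p) (x : H2), defect b x = y → inner ℂ g (s y) = inner ℂ g x := fun y x hx => by
    rw [← sub_eq_zero, ← inner_sub_right]
    exact hker _ (by rw [map_sub, hs, hx, sub_self])
  let l : p →ₗ[ℂ] ℂ :=
    { toFun := fun y => inner ℂ g (s y)
      map_add' := fun y z => by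
        rw [← inner_add_right]
        exact hsx _ _ (by rw [map_add, hs, hs]; rfl)
      map_smul' := fun c y => by
        rw [RingHom.id_apply, smul_eq_mul, ← inner_smul_right]
        exact hsx _ _ (by rw [map_smul, hs]; rfl) }
  let l' : StrongDual ℂ p := l.mkContinuous M fun y => by
    refine (hg (s y)).trans_eq ?_
    rw [hs]; rfl
  -- Hahn–Banach and Riesz give y with ⟨y, Dx⟩ = ⟨g, x⟩ and ‖y‖ ≤ M; since D is symmetric, Dy = g.
  obtain ⟨L, hL, hLn⟩ := exists_extension_norm_eq p l'
  let y := (InnerProductSpace.toDual ℂ H2).symm L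
  have hyM : ‖y‖ ≤ M := by
    rw [LinearIsometryEquiv.norm_map, hLn]
    exact l.mkContinuous_norm_le hM _
  have hy : defect b y = g := by
    refine ext_inner_right ℂ fun x => ?_
    rw [defect_isSymmetric]
    have h1 : inner ℂ y (defect b x) = L (defect b x) := InnerProductSpace.toDual_symm_apply
    rw [h1, hL ⟨defect b x, x, rfl⟩]
    exact hsx ⟨defect b x, x, rfl⟩ x rfl
  -- The norm of ℋ(b) is read off on (ker D)ᗮ; projecting y there keeps Dy and does not increase the
  -- norm.
  let z := (defect b).toLinearMap.kerᗮ.orthogonalProjectionOnto y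
  have hz : defect b (y - z) = 0 := by
    have : y - z ∈ (defect b).toLinearMap.kerᗮᗮ :=
      (defect b).toLinearMap.kerᗮ.sub_starProjection_mem_orthogonal y
    rw [Submodule.orthogonal_orthogonal] at this
    exact this
  refine ⟨Hb.param b z, ?_, ?_⟩
  · rw [Hb.toH2_param, ← hy, eq_comm, ← sub_eq_zero, ← map_sub, hz]
  · change ‖(Hb.param b).symm (Hb.param b z)‖ ≤ _
    rw [LinearEquiv.symm_apply_apply]
    exact ((defect b).toLinearMap.kerᗮ.norm_orthogonalProjectionOnto_apply_le y).trans hyM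

include hbh in
-- Split T_h x = T_h u + T_b v with u = x − T_b T_{b̄} x and v = T_h T_{b̄} x. Moving h and b to the
-- other side pairs T_{h̄} q with u and T_{b̄} q with v, and |b|² + |h|² ≤ 1 gives ‖u‖² + ‖v‖² ≤
-- ‖Dx‖², D being the defect operator. By Douglas' criterion this bounds the ℋ(b) norm of T_{h̄} q.
lemma norm_inner_toeplitz_star_le (q x : H2) :
    ‖inner ℂ (toeplitz (star (h : LpT ∞)) q) x‖ ≤
      √(‖toeplitz (star (h : LpT ∞)) q‖ ^ 2 + ‖toeplitz (star (b : LpT ∞)) q‖ ^ 2) *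
        ‖defect b x‖ := by
  set y := toeplitz (star (b : LpT ∞)) x with hy
  set u := x - toeplitz (b : LpT ∞) y with hu
  set v := toeplitz (h : LpT ∞) y with hv
  have huv : toeplitz (h : LpT ∞) x = toeplitz (h : LpT ∞) u + toeplitz (b : LpT ∞) v := by
    rw [hu, hv, map_sub, toeplitz_comm b h]; abel
  have h1 : inner ℂ (toeplitz (star (h : LpT ∞)) q) x =
      inner ℂ (toeplitz (star (h : LpT ∞)) q) u + inner ℂ (toeplitz (star (b : LpT ∞)) q) v := by
    simp only [inner_toeplitz_star_left, huv, inner_add_right]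
  have h2 : ‖u‖ ^ 2 + ‖v‖ ^ 2 ≤ ‖defect b x‖ ^ 2 := by
    rw [norm_sq_defect hbh, hu, @norm_sub_sq ℂ, ← inner_toeplitz_star_left, ← hy,
      inner_self_eq_norm_sq]
    linarith [norm_sq_toeplitz_add_le hbh y]
  rw [h1]
  refine (norm_add_le _ _).trans ?_
  refine (add_le_add (norm_inner_le_norm _ _) (norm_inner_le_norm _ _)).trans ?_
  have h3 : ‖defect b x‖ = √(‖defect b x‖ ^ 2) := (Real.sqrt_sq (norm_nonneg _)).symm
  rw [h3, ← Real.sqrt_mul (by positivity)]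
  refine Real.le_sqrt_of_sq_le ?_
  set A := ‖toeplitz (star (h : LpT ∞)) q‖
  set B := ‖toeplitz (star (b : LpT ∞)) q‖
  refine le_trans ?_ (mul_le_mul_of_nonneg_left h2 (by positivity))
  nlinarith [sq_nonneg (A * ‖v‖ - B * ‖u‖)]

end Operators

/-! ### Co-analytic Toeplitz operators on polynomials -/

section BackwardShift

open Finset

/-- `∑_{k < N} c̄ₖ g_{m + k}`, the `m`-th coefficient of `T_{φ̄} g`, where `φ = ∑ cₖ zᵏ` and `g` is a
polynomial of degree less than `N`. -/
def conjToeplitz (N : ℕ) (c : PowerSeries ℂ) (g : ℕ → ℂ) (m : ℕ) : ℂ :=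
  ∑ k ∈ range N, conj (PowerSeries.coeff k c) * g (m + k)

lemma conjToeplitz_eq_zero {N : ℕ} {g : ℕ → ℂ} (hg : ∀ k, N ≤ k → g k = 0) (c : PowerSeries ℂ)
    {m : ℕ} (hm : N ≤ m) : conjToeplitz N c g m = 0 :=
  sum_eq_zero fun k _ => by rw [hg _ (by lia), mul_zero]

/-- Terms with i + j ≥ N vanish, so the double sum can be regrouped along diagonals. All sums are
finite, hence c and d may be arbitrary formal series, such as 1/h. -/
lemma conjToeplitz_mul {N : ℕ} {g : ℕ → ℂ} (hg : ∀ k, N ≤ k → g k = 0) (c d : PowerSeries ℂ)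
    (m : ℕ) : conjToeplitz N c (conjToeplitz N d g) m = conjToeplitz N (c * d) g m := by
  have h := sum_range_diag_flip N fun i j =>
    conj (PowerSeries.coeff i c) * (conj (PowerSeries.coeff j d) * g (m + i + j))
  calc _ = ∑ i ∈ range N, ∑ j ∈ range (N - i),
        conj (PowerSeries.coeff i c) * (conj (PowerSeries.coeff j d) * g (m + i + j)) := by
        refine sum_congr rfl fun i _ => ?_
        rw [conjToeplitz, mul_sum]
        refine (sum_subset (range_mono (Nat.sub_le N i)) fun j _ hj => ?_).symm
        rw [hg _ (by simp at hj; lia), mul_zero, mul_zero]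
    _ = _ := by
        rw [← h, conjToeplitz]
        refine sum_congr rfl fun k _ => ?_
        rw [PowerSeries.coeff_mul, Nat.sum_antidiagonal_eq_sum_range_succ
          (fun i j => PowerSeries.coeff i c * PowerSeries.coeff j d), map_sum, sum_mul]
        refine sum_congr rfl fun i hi => ?_
        have : m + i + (k - i) = m + k := by simp at hi; lia
        rw [this, map_mul, mul_assoc]

lemma conjToeplitz_one {N : ℕ} {g : ℕ → ℂ} (hg : ∀ k, N ≤ k → g k = 0) (m : ℕ) :
    conjToeplitz N 1 g m = g m := by
  rcases N.eq_zero_or_pos with rfl | hN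
  · simp [conjToeplitz, hg]
  · rw [conjToeplitz, sum_eq_single_of_mem 0 (mem_range.2 hN)]
    · simp
    · intro k _ hk
      simp [PowerSeries.coeff_one, hk]

lemma coeff_toeplitz_star_of_finite {N : ℕ} {q : H2}
    (hq : ∀ k, N ≤ k → coeff (H2.toLp q) k = 0) (β : Hinf) (m : ℕ) :
    coeff (H2.toLp (toeplitz (star (β : LpT ∞)) q)) m =
      conjToeplitz N (series (β : LpT ∞)) (coeff (H2.toLp q)) m := by
  refine (hasSum_coeff_toeplitz_star β q m).unique ?_
  simpa [conjToeplitz, series] using hasSum_sum_of_ne_finset_zero (L := .unconditional ℕ)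
    (s := range N)
    (f := fun i : ℕ => conj (coeff (β : LpT ∞) i) * coeff (H2.toLp q) (m + i)) (by
      intro k hk
      rw [hq _ (by simp at hk; lia), mul_zero])

lemma exists_coeff_eq_of_finite {N : ℕ} {g : ℕ → ℂ} (hg : ∀ k, N ≤ k → g k = 0) :
    ∃ q : H2, ∀ k, coeff (H2.toLp q) k = g k :=
  exists_coeff_eq (summable_of_ne_finset_zero (s := range N) fun k hk => by
    rw [hg k (by simpa using hk)]; simp)

/-- The witness is q = T_{1/h̄} g, with 1/h the formal inverse. It is again a polynomial, so no
boundedness of 1/h is needed. -/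
lemma exists_toeplitz_star_eq {h b : Hinf} {c : PowerSeries ℂ} (h0 : coeff (h : LpT ∞) 0 ≠ 0)
    (hc : c * series (h : LpT ∞) = series (b : LpT ∞)) {N : ℕ} {g : H2}
    (hg : ∀ k, N ≤ k → coeff (H2.toLp g) k = 0) :
    ∃ q : H2, toeplitz (star (h : LpT ∞)) q = g ∧ ∀ m,
      coeff (H2.toLp (toeplitz (star (b : LpT ∞)) q)) m =
        conjToeplitz N c (coeff (H2.toLp g)) m := by
  have hne : PowerSeries.constantCoeff (series (h : LpT ∞)) ≠ 0 := by
    simpa [series, ← PowerSeries.coeff_zero_eq_constantCoeff_apply] using h0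
  obtain ⟨q, hq⟩ := exists_coeff_eq_of_finite fun k hk =>
    conjToeplitz_eq_zero hg (series (h : LpT ∞))⁻¹ hk
  have hq' : coeff (H2.toLp q) = conjToeplitz N (series (h : LpT ∞))⁻¹ (coeff (H2.toLp g)) :=
    funext hq
  have hq0 : ∀ k, N ≤ k → coeff (H2.toLp q) k = 0 := fun k hk => by
    rw [hq, conjToeplitz_eq_zero hg _ hk]
  refine ⟨q, H2.ext_coeff fun m => ?_, fun m => ?_⟩
  · rw [coeff_toeplitz_star_of_finite hq0, hq', conjToeplitz_mul hg, PowerSeries.mul_inv_cancel _ hne,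
      conjToeplitz_one hg]
  · rw [coeff_toeplitz_star_of_finite hq0, hq', conjToeplitz_mul hg, ← hc, mul_assoc,
      PowerSeries.mul_inv_cancel _ hne, mul_one]

end BackwardShift

/-! ### Coefficient multipliers from H² into ℋ(b) -/

section Multiplier

open Finset

/-- Write r^{m+k} = √r^k · √r^k · r^m and apply Cauchy–Schwarz, one factor √r^k going with c_k. Of
the rest, r^k r^{2m} ≤ r^m is kept: summed over m it yields the 1/(1 − r) of C(c, r). -/
lemma norm_sq_conjToeplitz_le {r : ℝ} (hr : r ∈ Set.Ico (0 : ℝ) 1) {c : PowerSeries ℂ}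
    (hc : Summable fun j : ℕ => r ^ j * ‖PowerSeries.coeff j c‖ ^ 2) (f : H2) {g : ℕ → ℂ}
    (hg : ∀ k, ‖g k‖ ≤ r ^ k * ‖coeff (H2.toLp f) k‖) (N m : ℕ) :
    ‖conjToeplitz N c g m‖ ^ 2 ≤
      (∑' j : ℕ, r ^ j * ‖PowerSeries.coeff j c‖ ^ 2) * ‖f‖ ^ 2 * r ^ m := by
  have hr0 := hr.1
  have hr1 := hr.2.le
  have h1 : ‖conjToeplitz N c g m‖ ≤ ∑ k ∈ range N,
      (√r ^ k * ‖PowerSeries.coeff k c‖) * (√r ^ k * r ^ m * ‖coeff (H2.toLp f) (m + k)‖) := by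
    refine (norm_sum_le _ _).trans (sum_le_sum fun k _ => ?_)
    rw [norm_mul, RCLike.norm_conj]
    calc _ ≤ ‖PowerSeries.coeff k c‖ * (r ^ (m + k) * ‖coeff (H2.toLp f) (m + k)‖) := by
          gcongr; exact hg _
      _ = ‖PowerSeries.coeff k c‖ * (r ^ m * (√r * √r) ^ k * ‖coeff (H2.toLp f) (m + k)‖) := by
          rw [Real.mul_self_sqrt hr0, pow_add]
      _ = _ := by rw [mul_pow]; ring
  have h2 : ∑ k ∈ range N, (√r ^ k * ‖PowerSeries.coeff k c‖) ^ 2 ≤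
      ∑' j : ℕ, r ^ j * ‖PowerSeries.coeff j c‖ ^ 2 := by
    refine le_trans (le_of_eq (sum_congr rfl fun k _ => ?_))
      (hc.sum_le_tsum (range N) fun k _ => by positivity)
    rw [mul_pow, ← pow_mul, mul_comm k 2, pow_mul, Real.sq_sqrt hr0]
  have h3 : ∑ k ∈ range N, (√r ^ k * r ^ m * ‖coeff (H2.toLp f) (m + k)‖) ^ 2 ≤
      ‖f‖ ^ 2 * r ^ m := by
    calc _ ≤ ∑ k ∈ range N, ‖coeff (H2.toLp f) (m + k)‖ ^ 2 * r ^ m := by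
          refine sum_le_sum fun k _ => ?_
          have e1 : (√r ^ k) ^ 2 ≤ 1 :=
            pow_le_one₀ (by positivity) (pow_le_one₀ (by positivity) (Real.sqrt_le_one.2 hr1))
          have e2 : (r ^ m) ^ 2 ≤ r ^ m := by
            rw [sq]; exact mul_le_of_le_one_left (by positivity) (pow_le_one₀ hr0 hr1)
          rw [mul_pow, mul_pow, mul_comm]
          gcongr
          calc _ ≤ 1 * r ^ m := by gcongr
            _ = _ := one_mul _
      _ ≤ _ := by
          rw [← sum_mul]
          gcongr
          have := sum_le_hasSum (range N |>.map (addLeftEmbedding m))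
            (fun k _ => by positivity) (hasSum_sq_coeff f)
          simpa using this
  calc _ ≤ (∑ k ∈ range N,
      (√r ^ k * ‖PowerSeries.coeff k c‖) * (√r ^ k * r ^ m * ‖coeff (H2.toLp f) (m + k)‖)) ^ 2 := by
        gcongr
    _ ≤ _ := sum_mul_sq_le_sq_mul_sq _ _ _
    _ ≤ _ := by
        rw [mul_assoc]
        gcongr

/-- A coefficient multiplier `w` with `|wₖ| ≤ rᵏ` maps `H²` to `ℋ(b)`. -/
theorem exists_multiplier {b h : Hinf}
    (hbh : ∀ᵐ t ∂mT, ‖(b : LpT ∞) t‖ ^ 2 + ‖(h : LpT ∞) t‖ ^ 2 ≤ 1)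
    (h0 : coeff (h : LpT ∞) 0 ≠ 0) {c : PowerSeries ℂ}
    (hc : c * series (h : LpT ∞) = series (b : LpT ∞)) {r : ℝ} (hr : r ∈ Set.Ico (0 : ℝ) 1)
    (hs : Summable fun j : ℕ => r ^ j * ‖PowerSeries.coeff j c‖ ^ 2) {w : ℕ → ℂ}
    (hw : ∀ k, ‖w k‖ ≤ r ^ k) (f : H2) :
    ∃ F : Hb b, (∀ k, coeff (H2.toLp (Hb.toH2 F)) k = w k * coeff (H2.toLp f) k) ∧
      ‖F‖ ≤ √(1 + (∑' j : ℕ, r ^ j * ‖PowerSeries.coeff j c‖ ^ 2) / (1 - r)) * ‖f‖ := by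
  have hr0 := hr.1
  have hr1 := hr.2.le
  set S := ∑' j : ℕ, r ^ j * ‖PowerSeries.coeff j c‖ ^ 2 with hS
  have hS0 : 0 ≤ S := tsum_nonneg fun k => by positivity
  have hw1 : ∀ k, ‖w k‖ ≤ 1 := fun k => (hw k).trans (pow_le_one₀ hr0 hr1)
  have hle : ∀ k, ‖w k * coeff (H2.toLp f) k‖ ≤ ‖coeff (H2.toLp f) k‖ := fun k => by
    rw [norm_mul]; exact mul_le_of_le_one_left (norm_nonneg _) (hw1 k)
  obtain ⟨g, hg⟩ := exists_coeff_eq (c := fun k => w k * coeff (H2.toLp f) k)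
    ((hasSum_sq_coeff f).summable.of_nonneg_of_le (fun k => by positivity) fun k => by
      gcongr; exact hle k)
  have key : ∀ x, ‖inner ℂ g x‖ ≤ √(1 + S / (1 - r)) * ‖f‖ * ‖defect b x‖ := by
    intro x
    have hlim := (hasSum_inner_coeff g x).tendsto_sum_nat.norm
    -- It suffices to bound the pairing with each truncation p of g, uniformly in N.
    refine le_of_tendsto hlim (Filter.Eventually.of_forall fun N => ?_)
    obtain ⟨p, hp⟩ := exists_coeff_eq_of_finite (N := N)
      (g := fun k => if k < N then w k * coeff (H2.toLp f) k else 0)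
      fun k hk => by simp [not_lt.2 hk]
    have hp0 : ∀ k, N ≤ k → coeff (H2.toLp p) k = 0 := fun k hk => by
      rw [hp]; simp [not_lt.2 hk]
    have hpf : ∀ k, ‖coeff (H2.toLp p) k‖ ≤ r ^ k * ‖coeff (H2.toLp f) k‖ := fun k => by
      rw [hp]
      split_ifs
      · rw [norm_mul]; gcongr; exact hw k
      · rw [norm_zero]; positivity
    have hpx : ∑ k ∈ range N, conj (coeff (H2.toLp g) k) * coeff (H2.toLp x) k = inner ℂ p x := by
      rw [← (hasSum_sum_of_ne_finset_zero (L := .unconditional ℕ) (s := range N) fun k hk => by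
        rw [hp0 k (by simpa using hk)]; simp).unique (hasSum_inner_coeff p x)]
      refine sum_congr rfl fun k hk => ?_
      rw [hg, hp, if_pos (mem_range.1 hk)]
    rw [hpx]
    obtain ⟨q, hq, hq'⟩ := exists_toeplitz_star_eq h0 hc hp0
    have h1 := norm_inner_toeplitz_star_le hbh q x
    rw [hq] at h1
    refine h1.trans ?_
    gcongr
    refine Real.sqrt_le_iff.2 ⟨by positivity, ?_⟩
    rw [mul_pow, Real.sq_sqrt (add_nonneg zero_le_one (div_nonneg hS0 (by linarith))), add_mul,
      one_mul]
    gcongr ?_ + ?_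
    · refine hasSum_le (fun k => ?_) (hasSum_sq_coeff p) (hasSum_sq_coeff f)
      gcongr
      refine (hpf k).trans ?_
      exact mul_le_of_le_one_left (norm_nonneg _) (pow_le_one₀ hr0 hr1)
    · have hgeo := (hasSum_geometric_of_lt_one hr0 hr.2).mul_left (S * ‖f‖ ^ 2)
      refine (hasSum_le (fun m => ?_) (hasSum_sq_coeff _) hgeo).trans_eq (by ring)
      rw [hq']
      exact norm_sq_conjToeplitz_le hr hs f hpf N m
  obtain ⟨F, hF, hFn⟩ := exists_Hb_of_inner_le (by positivity) key
  exact ⟨F, fun k => by rw [hF, hg], hFn⟩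

end Multiplier

open Filter Topology

/-! ### Holomorphic extensions and their Taylor coefficients -/

section Disc

lemma norm_fourierCoeff_le {f : UnitAddCircle → ℂ} {M : ℝ} (hf : ∀ᵐ t ∂mT, ‖f t‖ ≤ M) (n : ℤ) :
    ‖fourierCoeff f n‖ ≤ M := by
  have h : ∀ᵐ t ∂mT, ‖(fourier (-n) t : ℂ) • f t‖ ≤ M := by
    filter_upwards [hf] with t ht
    rwa [norm_smul, fourier_apply, Circle.norm_coe, one_mul]
  simpa [fourierCoeff] using norm_integral_le_of_norm_le_const h

lemma ae_norm_le_norm (f : LpT ∞) : ∀ᵐ t ∂mT, ‖f t‖ ≤ ‖f‖ := by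
  rw [Lp.norm_def, toReal_eLpNorm (Lp.aestronglyMeasurable f)]
  exact ae_le_lpNorm_exponent_top (Lp.memLp f)

lemma exists_norm_coeff_le (f : LpT ∞) : ∃ M : ℝ, ∀ n : ℕ, ‖coeff f n‖ ≤ M :=
  ⟨‖f‖, fun n => norm_fourierCoeff_le (ae_norm_le_norm f) n⟩

variable {f : UnitAddCircle → ℂ}

lemma summable_norm_coeff_mul_pow (hf : ∃ M : ℝ, ∀ n : ℕ, ‖coeff f n‖ ≤ M) {z : ℂ}
    (hz : ‖z‖ < 1) : Summable fun n : ℕ => ‖coeff f n * z ^ n‖ := by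
  obtain ⟨M, hM⟩ := hf
  refine ((summable_geometric_of_lt_one (norm_nonneg z) hz).mul_left M).of_nonneg_of_le
    (fun n => norm_nonneg _) fun n => ?_
  rw [norm_mul, norm_pow]
  gcongr
  exact hM n

lemma hasSum_eval (hf : ∃ M : ℝ, ∀ n : ℕ, ‖coeff f n‖ ≤ M) {z : ℂ} (hz : ‖z‖ < 1) :
    HasSum (fun n : ℕ => coeff f n * z ^ n) (eval f z) :=
  (summable_norm_coeff_mul_pow hf hz).of_norm.hasSum

lemma eval_zero (f : UnitAddCircle → ℂ) : eval f 0 = coeff f 0 := by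
  rw [eval, tsum_eq_single 0 fun n hn => by simp [hn]]
  simp

lemma hasFPowerSeriesOnBall_eval (hf : ∃ M : ℝ, ∀ n : ℕ, ‖coeff f n‖ ≤ M) :
    HasFPowerSeriesOnBall (eval f) (FormalMultilinearSeries.ofScalars ℂ (coeff f)) 0 1 := by
  obtain ⟨M, hM⟩ := hf
  have hr : 1 ≤ (FormalMultilinearSeries.ofScalars ℂ (coeff f)).radius := by
    refine FormalMultilinearSeries.le_radius_of_bound _ M (r := 1) fun n => ?_
    simpa [FormalMultilinearSeries.ofScalars_norm] using hM n
  have h := (FormalMultilinearSeries.ofScalars ℂ (coeff f)).hasFPowerSeriesOnBall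
    (zero_lt_one.trans_le hr)
  have he : (FormalMultilinearSeries.ofScalars ℂ (coeff f)).sum = eval f := by
    ext z
    rw [← FormalMultilinearSeries.ofScalarsSum, FormalMultilinearSeries.ofScalarsSum_eq_tsum]
    simp [eval]
  rw [he] at h
  exact h.mono zero_lt_one hr

lemma differentiableOn_eval (hf : ∃ M : ℝ, ∀ n : ℕ, ‖coeff f n‖ ≤ M) :
    DifferentiableOn ℂ (eval f) (Metric.ball 0 1) := by
  have h := (hasFPowerSeriesOnBall_eval hf).differentiableOn
  rwa [← ENNReal.ofReal_one, Metric.eball_ofReal] at h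

lemma taylorCoeff_eval (hf : ∃ M : ℝ, ∀ n : ℕ, ‖coeff f n‖ ≤ M) (n : ℕ) :
    taylorCoeff (eval f) n = coeff f n := by
  have h := (hasFPowerSeriesOnBall_eval hf).hasFPowerSeriesAt
  have h2 := h.analyticAt.hasFPowerSeriesAt.eq_formalMultilinearSeries h
  exact congrFun (FormalMultilinearSeries.ofScalars_series_injective ℂ ℂ h2) n

lemma taylorCoeff_mul {φ ψ : ℂ → ℂ} (hφ : AnalyticAt ℂ φ 0) (hψ : AnalyticAt ℂ ψ 0) :
    PowerSeries.mk (taylorCoeff (φ * ψ)) =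
      PowerSeries.mk (taylorCoeff φ) * PowerSeries.mk (taylorCoeff ψ) := by
  ext n
  rw [PowerSeries.coeff_mul, Finset.Nat.sum_antidiagonal_eq_sum_range_succ
    (fun i j => PowerSeries.coeff i (PowerSeries.mk (taylorCoeff φ)) *
      PowerSeries.coeff j (PowerSeries.mk (taylorCoeff ψ)))]
  simp only [PowerSeries.coeff_mk]
  rw [taylorCoeff, iteratedDeriv_mul hφ.contDiffAt hψ.contDiffAt, Finset.sum_div]
  refine Finset.sum_congr rfl fun i hi => ?_
  have hi' : i ≤ n := by simp at hi; lia
  rw [taylorCoeff, taylorCoeff, Nat.cast_choose ℂ hi']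
  have h1 : (n.factorial : ℂ) ≠ 0 := by exact_mod_cast n.factorial_ne_zero
  have h2 : (i.factorial : ℂ) ≠ 0 := by exact_mod_cast i.factorial_ne_zero
  have h3 : ((n - i).factorial : ℂ) ≠ 0 := by exact_mod_cast (n - i).factorial_ne_zero
  field_simp

/-- For √r < s < ρ the Taylor series converges at s, so |c_j| s^j ≤ M and the terms are at most M²
(r/s²)^j. As c_j is squared, only √r has to lie inside the disc. -/
lemma summable_taylorCoeff {φ : ℂ → ℂ} {ρ r : ℝ} (hφ : DifferentiableOn ℂ φ (Metric.ball 0 ρ))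
    (hρ : 0 < ρ) (hr : 0 ≤ r) (hrρ : r < ρ ^ 2) :
    Summable fun j : ℕ => r ^ j * ‖taylorCoeff φ j‖ ^ 2 := by
  obtain ⟨s, hs, hsρ⟩ := exists_between ((Real.sqrt_lt' hρ).2 hrρ)
  have hs0 : 0 < s := (Real.sqrt_nonneg r).trans_lt hs
  have hrs : r < s ^ 2 := (Real.sqrt_lt' hs0).1 hs
  have hz : (s : ℂ) ∈ Metric.ball (0 : ℂ) ρ := by
    simpa [abs_of_pos hs0] using hsρ
  have h := (Complex.hasSum_taylorSeries_on_ball hφ hz).summable.tendsto_atTop_zero.norm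
  obtain ⟨M, hM⟩ := h.bddAbove_range
  have hM' : ∀ j, ‖taylorCoeff φ j‖ * s ^ j ≤ M := fun j => by
    refine le_of_eq_of_le ?_ (hM ⟨j, rfl⟩)
    simp only [taylorCoeff, sub_zero, norm_smul, norm_div, norm_inv, norm_pow, Complex.norm_real,
      Real.norm_of_nonneg hs0.le]
    ring
  have hgeo := (summable_geometric_of_lt_one (div_nonneg hr (sq_nonneg s))
    ((div_lt_one (by positivity)).2 hrs)).mul_left (M ^ 2)
  refine hgeo.of_nonneg_of_le (fun j => by positivity) fun j => ?_
  have h1 : (‖taylorCoeff φ j‖ * s ^ j) ^ 2 ≤ M ^ 2 := by gcongr; exact hM' j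
  calc r ^ j * ‖taylorCoeff φ j‖ ^ 2
      = (‖taylorCoeff φ j‖ * s ^ j) ^ 2 * (r / s ^ 2) ^ j := by
        rw [div_pow]; field_simp; ring
    _ ≤ _ := by gcongr

end Disc

/-! ### The quotient b/h -/

section Quotient

variable {b h : Hinf} {ρ : ℝ}

lemma differentiableOn_quotient (hρ1 : ρ ≤ 1) (hh : ∀ z, ‖z‖ < ρ → eval (h : LpT ∞) z ≠ 0) :
    DifferentiableOn ℂ (quotient b h) (Metric.ball 0 ρ) :=
  ((differentiableOn_eval (exists_norm_coeff_le b)).mono (Metric.ball_subset_ball hρ1)).div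
    ((differentiableOn_eval (exists_norm_coeff_le h)).mono (Metric.ball_subset_ball hρ1))
    fun z hz => hh z (by simpa using hz)

lemma taylor_quotient_mul (hρ0 : 0 < ρ) (hρ1 : ρ ≤ 1)
    (hh : ∀ z, ‖z‖ < ρ → eval (h : LpT ∞) z ≠ 0) :
    PowerSeries.mk (taylorCoeff (quotient b h)) * series (h : LpT ∞) = series (b : LpT ∞) := by
  have hball : Metric.ball (0 : ℂ) ρ ∈ 𝓝 0 := Metric.ball_mem_nhds _ hρ0
  have h1 : series (h : LpT ∞) = PowerSeries.mk (taylorCoeff (eval (h : LpT ∞))) := by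
    ext n; simp [series, taylorCoeff_eval (exists_norm_coeff_le (h : LpT ∞))]
  have h2 : series (b : LpT ∞) = PowerSeries.mk (taylorCoeff (eval (b : LpT ∞))) := by
    ext n; simp [series, taylorCoeff_eval (exists_norm_coeff_le (b : LpT ∞))]
  have ha : AnalyticAt ℂ (eval (h : LpT ∞)) 0 :=
    (hasFPowerSeriesOnBall_eval (exists_norm_coeff_le (h : LpT ∞))).analyticAt
  rw [h1, h2, ← taylorCoeff_mul ((differentiableOn_quotient hρ1 hh).analyticAt hball) ha]
  congr 1
  ext n
  rw [taylorCoeff, taylorCoeff]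
  congr 1
  refine Filter.EventuallyEq.iteratedDeriv_eq n ?_
  filter_upwards [hball] with z hz
  exact div_mul_cancel₀ _ (hh z (by simpa using hz))

/-- A coefficient multiplier `w` with `|wₖ| ≤ rᵏ` maps `H²` to `ℋ(b)`, with a bound given by any
contractive complement `h` of `b` without zeros in a disc of radius greater than `√r`. -/
theorem exists_multiplier_of_ne_zero
    (hbh : ∀ᵐ t ∂mT, ‖(b : LpT ∞) t‖ ^ 2 + ‖(h : LpT ∞) t‖ ^ 2 ≤ 1)
    (hρ0 : 0 < ρ) (hρ1 : ρ ≤ 1) (hh : ∀ z, ‖z‖ < ρ → eval (h : LpT ∞) z ≠ 0) {r : ℝ}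
    (hr : r ∈ Set.Ico (0 : ℝ) 1) (hrρ : r < ρ ^ 2) {w : ℕ → ℂ} (hw : ∀ k, ‖w k‖ ≤ r ^ k)
    (f : H2) :
    ∃ F : Hb b, (∀ k, coeff (H2.toLp (Hb.toH2 F)) k = w k * coeff (H2.toLp f) k) ∧
      ‖F‖ ≤ √(constC (quotient b h) r) * ‖f‖ := by
  have h0 : coeff (h : LpT ∞) 0 ≠ 0 := by
    rw [← eval_zero]; exact hh 0 (by simpa using hρ0)
  have hs := summable_taylorCoeff (differentiableOn_quotient (b := b) hρ1 hh) hρ0 hr.1 hrρ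
  have := exists_multiplier hbh h0 (taylor_quotient_mul hρ0 hρ1 hh) hr (by simpa using hs) hw f
  simpa [constC] using this

end Quotient

/-! ### Dividing out zeros in H^∞ -/

section Blaschke

lemma memLp_unimodular_mul {h : LpT ∞} {u : UnitAddCircle → ℂ} (hu : Continuous u)
    (hu1 : ∀ t, ‖u t‖ = 1) : MemLp (fun t => u t * h t) ∞ mT :=
  (Lp.memLp h).of_le (hu.aestronglyMeasurable.mul (Lp.aestronglyMeasurable h))
    (ae_of_all _ fun t => by rw [norm_mul, hu1, one_mul])

lemma fourierCoeff_sub {f g : UnitAddCircle → ℂ} (hf : Integrable f mT) (hg : Integrable g mT)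
    (n : ℤ) : fourierCoeff (fun t => f t - g t) n = fourierCoeff f n - fourierCoeff g n := by
  simp only [fourierCoeff, smul_sub]
  exact integral_sub (hf.fourier_smul _) (hg.fourier_smul _)

/-- Division by a power of `z`. -/
lemma exists_shift {h : Hinf} {k : ℕ} (hk : ∀ j < k, coeff (h : LpT ∞) j = 0) :
    ∃ g : Hinf, (∀ᵐ t ∂mT, ‖(g : LpT ∞) t‖ = ‖(h : LpT ∞) t‖) ∧
      coeff (g : LpT ∞) 0 = coeff (h : LpT ∞) k := by
  have hm := memLp_fourier_mul (Lp.memLp (h : LpT ∞)) (-k : ℤ)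
  have hc : ∀ n : ℤ, fourierCoeff hm.toLp n = fourierCoeff (h : LpT ∞) (n + k) := fun n => by
    rw [fourierCoeff_congr_ae hm.coeFn_toLp, fourierCoeff_fourier_mul, sub_neg_eq_add]
  refine ⟨⟨hm.toLp, fun n hn => ?_⟩, ?_, ?_⟩
  · rw [hc]
    rcases lt_or_ge (n + k) 0 with h0 | h0
    · exact h.2 _ h0
    · have := hk (n + k).toNat (by lia)
      rwa [coeff, Int.toNat_of_nonneg h0] at this
  · filter_upwards [hm.coeFn_toLp] with t ht
    rw [ht, norm_mul, fourier_apply, Circle.norm_coe, one_mul]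
  · rw [coeff, hc, coeff]; simp

/-- Division by a Blaschke factor. -/
lemma exists_blaschke_div {h : Hinf} {z : ℂ} (hz : ‖z‖ < 1) (h0 : eval (h : LpT ∞) z = 0) :
    ∃ g : Hinf, (∀ᵐ t ∂mT, ‖(g : LpT ∞) t‖ = ‖(h : LpT ∞) t‖) ∧
      coeff (h : LpT ∞) 0 = -z * coeff (g : LpT ∞) 0 := by
  let e : UnitAddCircle → ℂ := fun t => fourier 1 t
  have he : ∀ t, ‖e t‖ = 1 := fun t => by simp only [e, fourier_apply, Circle.norm_coe]
  have hec : Continuous e := map_continuous (fourier (T := (1 : ℝ)) 1)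
  have hne : ∀ t, e t - z ≠ 0 := fun t h => by
    rw [sub_eq_zero] at h
    rw [← h, he] at hz
    exact lt_irrefl _ hz
  -- The reciprocal of the Blaschke factor of z, unimodular on the circle.
  let u : UnitAddCircle → ℂ := fun t => (1 - conj z * e t) / (e t - z)
  have hu : Continuous u := by
    refine Continuous.div ?_ ?_ hne <;> fun_prop
  have hu1 : ∀ t, ‖u t‖ = 1 := fun t => by
    have h1 : 1 - conj z * e t = e t * conj (e t - z) := by
      rw [map_sub, mul_sub, Complex.mul_conj', he]; push_cast; ring
    simp only [u]
    rw [h1, norm_div, norm_mul, he, RCLike.norm_conj, one_mul, div_self]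
    exact norm_ne_zero_iff.2 (hne t)
  have hm := memLp_unimodular_mul (h := h) hu hu1
  obtain ⟨g, hg⟩ : ∃ g : LpT ∞, g =ᵐ[mT] fun t => u t * (h : LpT ∞) t :=
    ⟨hm.toLp, hm.coeFn_toLp⟩
  have hg1 : ∀ᵐ t ∂mT, ‖g t‖ = ‖(h : LpT ∞) t‖ := by
    filter_upwards [hg] with t ht
    rw [ht, norm_mul, hu1, one_mul]
  -- Coefficients of (e − z) g = (1 − z̄ e) h.
  have hrec : ∀ n : ℤ, fourierCoeff g (n - 1) - z * fourierCoeff g n =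
      fourierCoeff (h : LpT ∞) n - conj z * fourierCoeff (h : LpT ∞) (n - 1) := by
    intro n
    have hi : ∀ f : LpT ∞, Integrable f mT := fun f => integrable_of_one_le le_top f
    have hei : ∀ f : LpT ∞, Integrable (fun t => e t * f t) mT := fun f =>
      (memLp_fourier_mul (Lp.memLp f) 1).integrable le_top
    have h1 : (fun t => e t * g t - z * g t) =ᵐ[mT]
        fun t => (h : LpT ∞) t - conj z * (e t * (h : LpT ∞) t) := by
      filter_upwards [hg] with t ht
      rw [ht]
      simp only [u]
      field_simp [hne t]
    have h2 := congrFun (fourierCoeff_congr_ae h1) n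
    rwa [fourierCoeff_sub (hei g) ((hi g).const_mul z),
      fourierCoeff_sub (hi h) ((hei h).const_mul _), fourierCoeff.const_mul, fourierCoeff.const_mul,
      fourierCoeff_fourier_mul, fourierCoeff_fourier_mul] at h2
  let P : ℕ → ℂ := fun K => ∑ n ∈ Finset.range K, coeff (h : LpT ∞) n * z ^ n
  -- Iterating the recursion upwards from index −1; as K → ∞ both partial sums tend to h(z) = 0,
  -- which forces the coefficient at −1 to vanish.
  have htel : ∀ K : ℕ, fourierCoeff g (-1) =
      z ^ (K + 1) * fourierCoeff g K + P (K + 1) - conj z * z * P K := by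
    intro K
    induction K with
    | zero =>
      have h1 := hrec 0
      rw [zero_sub, h.2 (-1) (by norm_num)] at h1
      simp [P, coeff]
      linear_combination h1
    | succ K ih =>
      have h1 := hrec (K + 1 : ℕ)
      have h2 : (((K + 1 : ℕ) : ℤ) - 1) = (K : ℤ) := by push_cast; ring
      rw [h2] at h1
      have h3 : P (K + 2) = P (K + 1) + fourierCoeff (h : LpT ∞) (K + 1 : ℕ) * z ^ (K + 1) :=
        Finset.sum_range_succ _ _
      have h4 : P (K + 1) = P K + fourierCoeff (h : LpT ∞) (K : ℕ) * z ^ K :=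
        Finset.sum_range_succ _ _
      rw [ih, h3]
      linear_combination z ^ (K + 1) * h1 + conj z * z * h4
  have hlim : Tendsto (fun K : ℕ => z ^ (K + 1) * fourierCoeff g K + P (K + 1) - conj z * z * P K)
      atTop (𝓝 (0 + 0 - conj z * z * 0)) := by
    have hP : Tendsto P atTop (𝓝 0) := by
      rw [← h0]
      exact (hasSum_eval (exists_norm_coeff_le h) hz).tendsto_sum_nat
    refine (Tendsto.add ?_ (hP.comp (tendsto_add_atTop_nat 1))).sub (hP.const_mul _)
    have hgeo := ((tendsto_pow_atTop_nhds_zero_of_lt_one (norm_nonneg z) hz).comp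
      (tendsto_add_atTop_nat 1)).mul_const ‖g‖
    rw [zero_mul] at hgeo
    refine squeeze_zero_norm (fun K => ?_) hgeo
    rw [norm_mul, norm_pow]
    simp only [Function.comp]
    gcongr
    exact norm_fourierCoeff_le (ae_norm_le_norm g) _
  have hm1 : fourierCoeff g (-1) = 0 := by
    have : (fun K : ℕ => z ^ (K + 1) * fourierCoeff g K + P (K + 1) - conj z * z * P K) =
      fun _ => fourierCoeff g (-1) := funext fun K => (htel K).symm
    rw [this] at hlim
    simpa using tendsto_nhds_unique tendsto_const_nhds hlim
  -- Below −1 the right side of the recursion is zero, so vanishing propagates downwards.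
  have hneg : ∀ m : ℕ, fourierCoeff g (-1 - m) = 0 := by
    intro m
    induction m with
    | zero => simpa using hm1
    | succ m ih =>
      have h1 := hrec (-1 - m)
      rw [ih, h.2 _ (by lia), h.2 _ (by lia)] at h1
      have h2 : (-1 - ((m + 1 : ℕ) : ℤ)) = -1 - m - 1 := by push_cast; ring
      rw [h2]
      linear_combination h1
  refine ⟨⟨g, fun n hn => ?_⟩, hg1, ?_⟩
  · have := hneg (-1 - n).toNat
    rwa [Int.toNat_of_nonneg (by lia), sub_sub_cancel] at this
  · have h1 := hrec 0
    rw [zero_sub, hm1, h.2 (-1) (by norm_num)] at h1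
    simp only [coeff, Nat.cast_zero]
    linear_combination -h1

end Blaschke

/-! ### Zero-free complements of a non-extreme b -/

section NonExtreme

variable {b : Hinf}

/-- The parallelogram law, applied pointwise on the circle. -/
lemma ae_norm_sq_add_le {b k : Hinf} (h1 : ‖b + k‖ ≤ 1) (h2 : ‖b - k‖ ≤ 1) :
    ∀ᵐ t ∂mT, ‖(b : LpT ∞) t‖ ^ 2 + ‖(k : LpT ∞) t‖ ^ 2 ≤ 1 := by
  filter_upwards [ae_norm_le_norm ((b + k : Hinf) : LpT ∞), ae_norm_le_norm ((b - k : Hinf) : LpT ∞),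
    Lp.coeFn_add (b : LpT ∞) (k : LpT ∞), Lp.coeFn_sub (b : LpT ∞) (k : LpT ∞)] with t e1 e2 e3 e4
  have f1 : ‖(b : LpT ∞) t + (k : LpT ∞) t‖ ≤ 1 := by
    rw [← Pi.add_apply, ← e3]; exact e1.trans h1
  have f2 : ‖(b : LpT ∞) t - (k : LpT ∞) t‖ ≤ 1 := by
    rw [← Pi.sub_apply, ← e4]; exact e2.trans h2
  have := parallelogram_law_with_norm ℂ ((b : LpT ∞) t) ((k : LpT ∞) t)
  nlinarith [norm_nonneg ((b : LpT ∞) t + (k : LpT ∞) t),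
    norm_nonneg ((b : LpT ∞) t - (k : LpT ∞) t)]

lemma IsNonExtreme.exists_ne_zero (hb : IsNonExtreme b) :
    ∃ k : Hinf, k ≠ 0 ∧ ∀ᵐ t ∂mT, ‖(b : LpT ∞) t‖ ^ 2 + ‖(k : LpT ∞) t‖ ^ 2 ≤ 1 := by
  obtain ⟨hb1, hb2⟩ := hb
  rw [mem_extremePoints] at hb2
  push Not at hb2
  obtain ⟨x, hx, y, hy, ⟨s, t, hs, ht, hst, hxy⟩, hne⟩ := hb2 hb1
  have hxy' : x ≠ y := by
    rintro rfl
    rw [← add_smul, hst, one_smul] at hxy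
    exact hne hxy hxy
  -- For this τ the points b ± τ(x − y) stay on the segment from x to y, since s ± τ and t ∓ τ are
  -- nonnegative.
  let τ := min s t
  have hτ : 0 < τ := lt_min hs ht
  have hconv := convex_closedBall (0 : Hinf) (1 : ℝ)
  refine ⟨τ • (x - y), smul_ne_zero hτ.ne' (sub_ne_zero.2 hxy'), ae_norm_sq_add_le ?_ ?_⟩
  · have h := hconv hx hy (a := s + τ) (b := t - τ) (by positivity)
      (sub_nonneg.2 (min_le_right _ _)) (by linarith)
    rw [mem_closedBall_zero_iff] at h
    have e : b + τ • (x - y) = (s + τ) • x + (t - τ) • y := by rw [← hxy]; module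
    rwa [← e] at h
  · have h := hconv hx hy (a := s - τ) (b := t + τ) (sub_nonneg.2 (min_le_left _ _))
      (by positivity) (by linarith)
    rw [mem_closedBall_zero_iff] at h
    have e : b - τ • (x - y) = (s - τ) • x + (t + τ) • y := by rw [← hxy]; module
    rwa [← e] at h

lemma exists_coeff_ne_zero {k : Hinf} (hk : k ≠ 0) : ∃ n, coeff (k : LpT ∞) n ≠ 0 := by
  by_contra! hc
  refine hk (Subtype.ext ?_)
  have h2 : (memLp_two (k : LpT ∞)).toLp = 0 := by
    apply (fourierBasis (T := (1 : ℝ))).repr.injective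
    ext n
    rw [fourierBasis_repr, map_zero, fourierCoeff_congr_ae (memLp_two (k : LpT ∞)).coeFn_toLp]
    rcases lt_or_ge n 0 with hn | hn
    · exact k.2 n hn
    · lift n to ℕ using hn
      exact hc n
  refine (Lp.eq_zero_iff_ae_eq_zero).2 ?_
  exact (memLp_two (k : LpT ∞)).coeFn_toLp.symm.trans ((Lp.eq_zero_iff_ae_eq_zero).1 h2)

/-- Take a complement h with |h(0)| > ρ σ, where σ is the supremum of |h(0)| over all complements. A
zero z with |z| < ρ could be divided out, giving a complement g with |h(0)| = |z| |g(0)| ≤ ρ σ, a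
contradiction. Dividing a nonzero complement by a power of z shows σ > 0. -/
lemma IsNonExtreme.exists_zeroFree (hb : IsNonExtreme b) {ρ : ℝ} (hρ0 : 0 < ρ) (hρ1 : ρ < 1) :
    ∃ h : Hinf, (∀ᵐ t ∂mT, ‖(b : LpT ∞) t‖ ^ 2 + ‖(h : LpT ∞) t‖ ^ 2 ≤ 1) ∧
      ∀ z, ‖z‖ < ρ → eval (h : LpT ∞) z ≠ 0 := by
  classical
  let S : Set ℝ := {x | ∃ h : Hinf,
    (∀ᵐ t ∂mT, ‖(b : LpT ∞) t‖ ^ 2 + ‖(h : LpT ∞) t‖ ^ 2 ≤ 1) ∧ x = ‖coeff (h : LpT ∞) 0‖}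
  have hbdd : BddAbove S := by
    refine ⟨1, ?_⟩
    rintro _ ⟨h, hh, rfl⟩
    refine norm_fourierCoeff_le ?_ _
    filter_upwards [hh] with t ht
    nlinarith [sq_nonneg ‖(b : LpT ∞) t‖, norm_nonneg ((h : LpT ∞) t)]
  have hpos : 0 < sSup S := by
    obtain ⟨k, hk, hbk⟩ := hb.exists_ne_zero
    have hex := exists_coeff_ne_zero hk
    obtain ⟨g, hg, hg0⟩ := exists_shift (h := k) (k := Nat.find hex) fun j hj => by
      simpa using Nat.find_min hex hj
    refine lt_of_lt_of_le (norm_pos_iff.2 (Nat.find_spec hex)) (le_csSup hbdd ⟨g, ?_, ?_⟩)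
    · filter_upwards [hg, hbk] with t h1 h2
      rwa [h1]
    · rw [hg0]
  obtain ⟨_, ⟨h, hh, rfl⟩, hlt⟩ := exists_lt_of_lt_csSup (Set.nonempty_iff_ne_empty.2 fun he => by
    rw [he, Real.sSup_empty] at hpos; exact lt_irrefl _ hpos)
    (mul_lt_of_lt_one_left hpos hρ1)
  refine ⟨h, hh, fun z hz h0 => ?_⟩
  obtain ⟨g, hg, hg0⟩ := exists_blaschke_div (hz.trans hρ1) h0
  have hgS : ‖coeff (g : LpT ∞) 0‖ ≤ sSup S := le_csSup hbdd ⟨g, by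
    filter_upwards [hg, hh] with t h1 h2
    rwa [h1], rfl⟩
  rw [hg0, norm_mul, norm_neg] at hlt
  have : ‖z‖ * ‖coeff (g : LpT ∞) 0‖ ≤ ρ * sSup S := by gcongr
  linarith

end NonExtreme

/-! ### The logarithmic mean as a coefficient multiplier -/

section LogMean

variable {r : ℝ}

lemma summable_pow_div (hr : r ∈ Set.Ico (0 : ℝ) 1) (k : ℕ) :
    Summable fun i : ℕ => r ^ (k + i) / ((k + i : ℕ) + 1 : ℝ) := by
  have hr0 := hr.1
  refine (summable_geometric_of_lt_one hr0 hr.2).of_nonneg_of_le (fun i => by positivity)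
    fun i => ?_
  refine (div_le_self (by positivity) (by simp; positivity)).trans ?_
  exact pow_le_pow_of_le_one hr0 hr.2.le (by lia)

lemma logSeries_pos (hr : r ∈ Set.Ico (0 : ℝ) 1) : 0 < logSeries r := by
  have hr0 := hr.1
  have h := summable_pow_div hr 0
  simp only [zero_add] at h
  have := h.le_tsum 0 fun i _ => by positivity
  simp only [pow_zero, Nat.cast_zero, zero_add, div_one] at this
  exact zero_lt_one.trans_le this

/-- The multiplier of `zᵏ` in the logarithmic mean. -/
def logWeight (r : ℝ) (k : ℕ) : ℝ :=
  (logSeries r)⁻¹ * ∑' i : ℕ, r ^ (k + i) / ((k + i : ℕ) + 1 : ℝ)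

/-- Termwise, r^{k+i}/(k+i+1) ≤ r^k · r^i/(i+1); the sum over i of the right side is r^k l(r). -/
lemma norm_logWeight_le (hr : r ∈ Set.Ico (0 : ℝ) 1) (k : ℕ) :
    ‖(logWeight r k : ℂ)‖ ≤ r ^ k := by
  have hr0 := hr.1
  have hl := logSeries_pos hr
  have h0 : 0 ≤ logWeight r k := mul_nonneg (by positivity) (tsum_nonneg fun i => by positivity)
  rw [Complex.norm_real, Real.norm_of_nonneg h0, logWeight, inv_mul_le_iff₀ hl, logSeries,
    ← tsum_mul_right]
  have h1 := summable_pow_div hr 0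
  simp only [zero_add] at h1
  refine (summable_pow_div hr k).tsum_le_tsum (fun i => ?_) (h1.mul_right _)
  rw [pow_add, mul_comm, div_mul_eq_mul_div]
  gcongr
  lia

lemma logMean_eq_tsum (hr : r ∈ Set.Ico (0 : ℝ) 1) {f : UnitAddCircle → ℂ}
    (hf : ∃ M : ℝ, ∀ n : ℕ, ‖coeff f n‖ ≤ M) {z : ℂ} (hz : ‖z‖ < 1) :
    logMean r f z = ∑' k : ℕ, (logWeight r k : ℂ) * coeff f k * z ^ k := by
  have hr0 := hr.1
  -- The pair (k, i) stands for the k-th term of s_n with n = k + i. Absolute summability permits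
  -- summing by k or along antidiagonals.
  let F : ℕ × ℕ → ℂ := fun p =>
    coeff f p.1 * z ^ p.1 * ((r ^ (p.1 + p.2) / ((p.1 + p.2 : ℕ) + 1 : ℝ) : ℝ) : ℂ)
  have hF : Summable F := by
    refine Summable.of_norm_bounded ((summable_norm_coeff_mul_pow hf hz).mul_of_nonneg
      (summable_geometric_of_lt_one hr0 hr.2) (fun _ => norm_nonneg _) fun _ => by positivity)
      fun p => ?_
    rw [norm_mul, Complex.norm_real, Real.norm_of_nonneg (by positivity)]
    gcongr
    refine (div_le_self (by positivity) (by simp; positivity)).trans ?_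
    exact pow_le_pow_of_le_one hr0 hr.2.le (by lia)
  have h1 : ∑' p, F p = logSeries r * ∑' k : ℕ, (logWeight r k : ℂ) * coeff f k * z ^ k := by
    rw [hF.tsum_prod, ← tsum_mul_left]
    congr 1 with k
    have hl : (logSeries r : ℂ) ≠ 0 := Complex.ofReal_ne_zero.2 (logSeries_pos hr).ne'
    simp only [F]
    rw [tsum_mul_left, ← Complex.ofReal_tsum, logWeight]
    rw [Complex.ofReal_mul, Complex.ofReal_inv]
    field_simp
  have h2 : ∑' p, F p = ∑' n : ℕ, partialSum f n z / ((n : ℂ) + 1) * (r : ℂ) ^ n := by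
    rw [← Finset.HasAntidiagonal.sigmaAntidiagonalEquivProd.tsum_eq F]
    refine (Finset.HasAntidiagonal.sigmaAntidiagonalEquivProd.summable_iff.2 hF).tsum_sigma.trans ?_
    congr 1 with n
    simp only [Function.comp]
    rw [tsum_fintype, Finset.univ_eq_attach]
    simp only [Finset.HasAntidiagonal.sigmaAntidiagonalEquivProd_apply]
    rw [Finset.sum_attach (Finset.HasAntidiagonal.antidiagonal n) F, Finset.Nat.sum_antidiagonal_eq_sum_range_succ_mk,
      partialSum, Finset.sum_div, Finset.sum_mul]
    refine Finset.sum_congr rfl fun k hk => ?_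
    have hk' : k + (n - k) = n := by simp at hk; lia
    simp only [F, hk']
    push_cast
    ring
  rw [logMean, ← h2, h1, inv_mul_cancel_left₀ (Complex.ofReal_ne_zero.2 (logSeries_pos hr).ne')]

end LogMean

/-! ### Pythagorean pairs, monotonicity and boundedness -/

lemma IsPythagoreanPair.eval_ne_zero {b a : Hinf} (h : IsPythagoreanPair b a) (z : ℂ)
    (hz : ‖z‖ < 1) : eval (a : LpT ∞) z ≠ 0 := by
  obtain ⟨⟨_, c, hc, hac⟩, _⟩ := h
  rw [hac z hz]
  exact mul_ne_zero (norm_ne_zero_iff.1 (by rw [hc]; exact one_ne_zero)) (Complex.exp_ne_zero _)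

lemma IsPythagoreanPair.ae_le {b a : Hinf} (h : IsPythagoreanPair b a) :
    ∀ᵐ t ∂mT, ‖(b : LpT ∞) t‖ ^ 2 + ‖(a : LpT ∞) t‖ ^ 2 ≤ 1 := by
  filter_upwards [h.2.2] with t ht
  rw [add_comm]; exact ht.le

lemma IsPythagoreanPair.summable {b a : Hinf} (h : IsPythagoreanPair b a) {r : ℝ}
    (hr : r ∈ Set.Ico (0 : ℝ) 1) :
    Summable fun j : ℕ => r ^ j * ‖taylorCoeff (quotient b a) j‖ ^ 2 :=
  summable_taylorCoeff (differentiableOn_quotient le_rfl h.eval_ne_zero) zero_lt_one hr.1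
    (by simpa using hr.2)

lemma monotoneOn_constC {φ : ℂ → ℂ} (h : ∀ r ∈ Set.Ico (0 : ℝ) 1,
    Summable fun j : ℕ => r ^ j * ‖taylorCoeff φ j‖ ^ 2) :
    MonotoneOn (constC φ) (Set.Ico (0 : ℝ) 1) := by
  intro r hr s hs hrs
  have hr0 := hr.1
  have hs0 := hs.1
  have hs1 : 0 < 1 - s := by linarith [hs.2]
  have h1 : ∑' j : ℕ, r ^ j * ‖taylorCoeff φ j‖ ^ 2 ≤ ∑' j : ℕ, s ^ j * ‖taylorCoeff φ j‖ ^ 2 :=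
    (h r hr).tsum_le_tsum (fun j => by gcongr) (h s hs)
  unfold constC
  gcongr

lemma Hb.toH2_injective {b : Hinf} : Function.Injective (Hb.toH2 (b := b)) :=
  Subtype.val_injective

lemma Hb.ext_coeff {b : Hinf} {F G : Hb b}
    (h : ∀ k, coeff (H2.toLp (Hb.toH2 F)) k = coeff (H2.toLp (Hb.toH2 G)) k) : F = G :=
  Hb.toH2_injective (H2.ext_coeff h)

/-- On `ℋ(b)`, `b` non-extreme, a coefficient multiplier `w` with `|wₖ| ≤ rᵏ` is bounded. -/
theorem IsNonExtreme.exists_clm {b : Hinf} (hb : IsNonExtreme b) {r : ℝ}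
    (hr : r ∈ Set.Ico (0 : ℝ) 1) {w : ℕ → ℂ} (hw : ∀ k, ‖w k‖ ≤ r ^ k) :
    ∃ L : Hb b →L[ℂ] Hb b, ∀ f k, coeff (H2.toLp (Hb.toH2 (L f))) k =
      w k * coeff (H2.toLp (Hb.toH2 f)) k := by
  -- The complement h depends on r through ρ > √r, but the operator does not depend on h: its
  -- coefficients determine it, which also gives linearity.
  obtain ⟨ρ, hrρ, hρ1⟩ := exists_between (α := ℝ) (Real.sqrt_lt_sqrt hr.1 hr.2)
  rw [Real.sqrt_one] at hρ1
  have hρ0 : 0 < ρ := (Real.sqrt_nonneg r).trans_lt hrρ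
  obtain ⟨h, hbh, hh⟩ := hb.exists_zeroFree hρ0 hρ1
  choose L hL hLn using fun f : Hb b =>
    exists_multiplier_of_ne_zero hbh hρ0 hρ1.le hh hr ((Real.sqrt_lt' hρ0).1 hrρ) hw (Hb.toH2 f)
  refine ⟨LinearMap.mkContinuous
    { toFun := L
      map_add' := fun f g => Hb.ext_coeff fun k => ?_
      map_smul' := fun c f => Hb.ext_coeff fun k => ?_ } (√(constC (quotient b h) r))
    fun f => ?_, hL⟩
  · rw [map_add, coeff_toLp_add, hL, hL, hL, map_add, coeff_toLp_add, mul_add]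
  · rw [RingHom.id_apply, map_smul, coeff_toLp_smul, hL, hL, map_smul, coeff_toLp_smul]
    ring
  · refine (hLn f).trans ?_
    gcongr
    exact norm_toH2_le hbh f

end DBR

end

theorem corollary4p3 (b : DBR.Hinf) (hb : DBR.IsNonExtreme b) :
    -- the constant `C(φ, r)` is finite and increasing in `r`
    (∀ a : DBR.Hinf, DBR.IsPythagoreanPair b a →
      (∀ r ∈ Set.Ico (0 : ℝ) 1,
        Summable fun j : ℕ => r ^ j * ‖DBR.taylorCoeff (DBR.quotient b a) j‖ ^ 2) ∧
      MonotoneOn (DBR.constC (DBR.quotient b a)) (Set.Ico (0 : ℝ) 1)) ∧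
    -- `L_r` is a bounded linear operator on `ℋ(b)`, with the stated bounds
    ∀ r ∈ Set.Ico (0 : ℝ) 1, ∃ L : DBR.Hb b →L[ℂ] DBR.Hb b,
      (∀ (f : DBR.Hb b) (z : ℂ), ‖z‖ < 1 →
        DBR.eval (DBR.H2.toLp (DBR.Hb.toH2 (L f))) z =
          DBR.logMean r (DBR.H2.toLp (DBR.Hb.toH2 f)) z) ∧
      ∀ a : DBR.Hinf, DBR.IsPythagoreanPair b a →
        ‖L‖ ≤ √(DBR.constC (DBR.quotient b a) r) ∧
        ∀ f : DBR.Hb b,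
          ‖L f‖ ≤ √(DBR.constC (DBR.quotient b a) r) * ‖DBR.Hb.toH2 f‖ := by
  refine ⟨fun a ha => ⟨fun r hr => ha.summable hr,
    DBR.monotoneOn_constC fun r hr => ha.summable hr⟩, fun r hr => ?_⟩
  have hw := DBR.norm_logWeight_le hr
  obtain ⟨L, hL⟩ := hb.exists_clm hr hw
  refine ⟨L, fun f z hz => ?_, fun a ha => ?_⟩
  · rw [DBR.logMean_eq_tsum hr ⟨_, DBR.norm_coeff_le _⟩ hz, DBR.eval]
    simp only [hL]
  · have hbound : ∀ f : DBR.Hb b,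
        ‖L f‖ ≤ √(DBR.constC (DBR.quotient b a) r) * ‖DBR.Hb.toH2 f‖ := fun f => by
      -- The same multiplier, now bounded with a as complement; equal coefficients identify its
      -- value F with `L f`, so the sharper constant applies to `L`.
      obtain ⟨F, hF, hFn⟩ := DBR.exists_multiplier_of_ne_zero ha.ae_le zero_lt_one le_rfl
        ha.eval_ne_zero hr (by simpa using hr.2) hw (DBR.Hb.toH2 f)
      have : L f = F := DBR.Hb.ext_coeff fun k => by rw [hL, hF]
      rwa [this]
    refine ⟨L.opNorm_le_bound (Real.sqrt_nonneg _) fun f => (hbound f).trans ?_, hbound⟩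
    gcongr
    exact DBR.norm_toH2_le ha.ae_le f
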